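/- **Setting.** Let $\mathcal M$ be a finite-dimensional smooth Riemannian manifold with Riemannian distance $\mathrm{dist}$, and let $R:T\mathcal M\to\mathcal M$ be a retraction defined on the whole tangent bundle, i.e. a $C^\infty$ map with $R_x(0_x)=x$ and $\frac{d}{dt}R_x(t\eta)|_{t=0}=\eta$. Let $F=f+g$ with $f,g:\mathcal M\to\mathbb R$, $f$ differentiable and $g$ continuous. For $h:\mathcal M\to\mathbb R$ let $\partial h(x)=\partial(h\circ R_x)(0_x)$ be the Riemannian (Clarke) generalized subdifferential. **Algorithm (IRPG).** Given $x_0\in\mathcal M$, $\tilde L>0$ and $\varepsilon_k>0$, put $$\ell_{x_k}(\eta)=\langle \operatorname{grad} f(x_k),\eta\rangle+\tfrac{\tilde L}{2}\|\eta\|^2+g(R_{x_k}(\eta)),\qquad \eta\in T_{x_k}\mathcal M .$$ Choose $\hat\eta_k\in T_{x_k}\mathcal M$ and a stationary point $\eta^*_k$ of $\ell_{x_k}$ (that is, $0\in\partial\ell_{x_k}(\eta_k^*)$, Clarke subdifferential) such that $$\|\hat\eta_k-\eta_k^*\|\le\varepsilon_k^2,\qquad \ell_{x_k}(\hat\eta_k)\le\ell_{x_k}(0),$$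 and set $x_{k+1}=R_{x_k}(\hat\eta_k)$, for $k=0,1,2,\dots$ **Theorem.** Let $\{x_k\}$ be generated by this algorithm with $\sum_k\varepsilon_k<\infty$, and let $\mathcal S$ be the set of accumulation points of $\{x_k\}$. Suppose that: 1. $F$ is bounded from below and $\Omega_{x_0}=\{x: F(x)\le F(x_0)\}$ is compact. 2. $f$ is $L$-retraction-smooth with $L<\tilde L$ in a set $\mathcal N\subseteq\mathcal M$ that contains $\Omega_{x_0}$ and all the iterates $x_k$: $f(R_x(\eta))\le f(x)+\langle\operatorname{grad} f(x),\eta\rangle+\frac L2\|\eta\|^2$ whenever $x\in\mathcal N$, $\eta\in T_x\mathcal M$ and $R_x(\eta)\in\mathcal N$. 3. $\operatorname{grad} f$ is a locally Lipschitz vector field: for every compact $K\subseteq\mathcal M$ there are $r,L_v>0$ such that $\|P_\gamma^{0\leftarrow1}\operatorname{grad} f(y)-\operatorname{grad} f(x)\|\le L_v\,\mathrm{dist}(x,y)$ for all $x,y\in K$ and every geodesic $\gamma:[0,1]\to\mathcal M$ of length less than $r$ with $\gamma(0)=x$, $\gamma(1)=y$, where $P_\gamma^{0\leftarrow 1}$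 is parallel translation along $\gamma$. 4. $F$ is locally Lipschitz continuous with respect to $R$: for every compact $K\subseteq\mathcal M$ there is a constant $L_F$ with $|F(R_x(\xi))-F(R_x(\eta))|\le L_F\|\xi-\eta\|$ whenever $x\in K$, $\xi,\eta\in T_x\mathcal M$ and $R_x(\xi),R_x(\eta)\in K$. 5. $F$ has the Riemannian Kurdyka–Łojasiewicz property at every $x\in\mathcal S$: there are $\varepsilon\in(0,\infty]$, a neighborhood $U$ of $x$ and a continuous concave $\varsigma:[0,\varepsilon]\to[0,\infty)$ (on $[0,\infty)$ if $\varepsilon=\infty$) with $\varsigma(0)=0$, $\varsigma$ of class $C^1$ and $\varsigma'>0$ on $(0,\varepsilon)$, such that $\varsigma'(F(y)-F(x))\cdot\inf\{\|v\|_y: v\in\partial F(y)\}\ge1$ for every $y\in U$ with $F(x)<F(y)<F(x)+\varepsilon$. Then $$\sum_{k=0}^\infty \mathrm{dist}(x_k,x_{k+1})<\infty ,$$ and $\mathcal S$ consists of exactly one point. -/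

import Mathlib

open Bundle Set Filter Topology
open scoped Manifold ContDiff ENNReal NNReal

namespace IRPG

noncomputable section

/-! ### Clarke calculus on a Hilbert space -/

section Clarke

variable {V : Type*} [NormedAddCommGroup V] [InnerProductSpace ℝ V]

/-- Clarke generalized directional derivative
`h°(u; v) = limsup_{ξ → u, t ↓ 0} (h (ξ + t v) - h ξ) / t`, as an extended real. -/
def clarkeDirDeriv (h : V → ℝ) (u v : V) : EReal :=
  limsup (fun p : V × ℝ => (((h (p.1 + p.2 • v) - h p.1) / p.2 : ℝ) : EReal))
    (𝓝 u ×ˢ 𝓝[>] (0 : ℝ))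

/-- Clarke generalized subdifferential of `h` at `u`. -/
def clarkeSubdiff (h : V → ℝ) (u : V) : Set V :=
  {ξ | ∀ v : V, ((inner ℝ ξ v : ℝ) : EReal) ≤ clarkeDirDeriv h u v}

end Clarke

variable {E : Type*} [NormedAddCommGroup E] [NormedSpace ℝ E] [FiniteDimensional ℝ E]
  {M : Type*} [EMetricSpace M] [ChartedSpace E M] [IsManifold 𝓘(ℝ, E) ∞ M]
  [RiemannianBundle (fun x : M => TangentSpace 𝓘(ℝ, E) x)]

/-! ### Retractions -/

variable (E M) in
/-- A retraction, defined on the whole tangent bundle: a smooth map `R : TM → M` with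
`R 0ₓ = x` and `d/dt R (t η)|_{t = 0} = η`. -/
structure Retraction where
  toFun : ∀ x : M, TangentSpace 𝓘(ℝ, E) x → M
  smooth : ContMDiff 𝓘(ℝ, E).tangent 𝓘(ℝ, E) ∞
    (fun p : TangentBundle 𝓘(ℝ, E) M => toFun p.1 p.2)
  map_zero : ∀ x : M, toFun x 0 = x
  deriv_zero : ∀ (x : M) (η : TangentSpace 𝓘(ℝ, E) x),
    (mfderiv 𝓘(ℝ, ℝ) 𝓘(ℝ, E) (fun t : ℝ => toFun x (t • η)) 0 (1 : ℝ) : E) = (η : E)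

instance : CoeFun (Retraction E M) (fun _ => ∀ x : M, TangentSpace 𝓘(ℝ, E) x → M) :=
  ⟨Retraction.toFun⟩

/-! ### Gradient, subdifferential -/

/-- Riemannian gradient: the Riesz representative of the differential. -/
def grad (h : M → ℝ) (x : M) : TangentSpace 𝓘(ℝ, E) x :=
  haveI : FiniteDimensional ℝ (TangentSpace 𝓘(ℝ, E) x) :=
    inferInstanceAs (FiniteDimensional ℝ E)
  haveI : CompleteSpace (TangentSpace 𝓘(ℝ, E) x) := FiniteDimensional.complete ℝ _
  (InnerProductSpace.toDual ℝ (TangentSpace 𝓘(ℝ, E) x)).symm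
    (mvfderiv 𝓘(ℝ, E) h x)

lemma inner_grad (h : M → ℝ) (x : M) (v : TangentSpace 𝓘(ℝ, E) x) :
    inner ℝ (grad h x) v = mvfderiv 𝓘(ℝ, E) h x v := by
  have : FiniteDimensional ℝ (TangentSpace 𝓘(ℝ, E) x) :=
    inferInstanceAs (FiniteDimensional ℝ E)
  have : CompleteSpace (TangentSpace 𝓘(ℝ, E) x) := FiniteDimensional.complete ℝ _
  exact InnerProductSpace.toDual_symm_apply

/-- Riemannian generalized subdifferential `∂h(x) = ∂(h ∘ Rₓ)(0ₓ)`. -/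
def subdiff (R : Retraction E M) (h : M → ℝ) (x : M) : Set (TangentSpace 𝓘(ℝ, E) x) :=
  clarkeSubdiff (fun η : TangentSpace 𝓘(ℝ, E) x => h (R x η)) 0

/-- `dist (0, ∂h(x)) = inf {‖v‖ : v ∈ ∂h(x)}` (equal to `∞` if `∂h(x)` is empty). -/
def distZeroSubdiff (R : Retraction E M) (h : M → ℝ) (x : M) : ℝ≥0∞ :=
  ⨅ v ∈ subdiff R h x, ‖v‖ₑ

/-! ### Geodesics and parallel transport -/

/-- Coordinates of a tangent vector at `y` in the chart around `p`. -/
def chartVec (p y : M) (v : TangentSpace 𝓘(ℝ, E) y) : E :=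
  mvfderiv 𝓘(ℝ, E) (extChartAt 𝓘(ℝ, E) p) y v

/-- The metric tensor in the chart around `p`, at the coordinate point `z`. -/
def chartMetric (p : M) (z u w : E) : ℝ :=
  let D := mfderiv 𝓘(ℝ, E) 𝓘(ℝ, E) (extChartAt 𝓘(ℝ, E) p).symm z
  inner ℝ (D u : TangentSpace 𝓘(ℝ, E) ((extChartAt 𝓘(ℝ, E) p).symm z)) (D w)

/-- Christoffel symbols of the first kind of the Levi-Civita connection in the chart around `p`:
`½ (∂ₐ G(b, w) + ∂_b G(a, w) - ∂_w G(a, b))`, the value of `G(Γ(a, b), w)`. -/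
def christoffel (p : M) (z a b w : E) : ℝ :=
  (fderiv ℝ (fun z' => chartMetric p z' b w) z a
    + fderiv ℝ (fun z' => chartMetric p z' a w) z b
    - fderiv ℝ (fun z' => chartMetric p z' a b) z w) / 2

/-- Velocity of a curve parametrized by `[0, 1]`. -/
def velocity (γ : ℝ → M) (t : ℝ) : TangentSpace 𝓘(ℝ, E) (γ t) :=
  mfderivWithin 𝓘(ℝ, ℝ) 𝓘(ℝ, E) γ (Icc 0 1) t (1 : ℝ)

/-- `W` is parallel along `γ : [0, 1] → M` for the Levi-Civita connection: at every time, in local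
coordinates, `v' + Γ(c', v) = 0`, where `c` and `v` are the coordinate expressions of `γ` and `W`;
the equation is paired with an arbitrary vector `w` in the metric. The equation is invariant under
change of coordinates, so that it does not matter which chart is used at a given time. -/
def IsParallel (γ : ℝ → M) (W : ∀ t, TangentSpace 𝓘(ℝ, E) (γ t)) : Prop :=
  ∀ t ∈ Icc (0 : ℝ) 1, ∃ p : M, γ t ∈ (chartAt E p).source ∧ ∃ v' : E,
    HasDerivWithinAt (fun s => chartVec p (γ s) (W s)) v' (Icc 0 1) t ∧
    ∀ w : E, chartMetric p (extChartAt 𝓘(ℝ, E) p (γ t)) v' w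
      + christoffel p (extChartAt 𝓘(ℝ, E) p (γ t))
          (chartVec p (γ t) (velocity γ t)) (chartVec p (γ t) (W t)) w = 0

variable (E) in
/-- `γ : [0, 1] → M` is a geodesic: its velocity is parallel along it. -/
def IsGeodesic (γ : ℝ → M) : Prop :=
  ContMDiffOn 𝓘(ℝ, ℝ) 𝓘(ℝ, E) 1 γ (Icc 0 1) ∧ IsParallel γ (velocity (E := E) γ)

/-- A vector field `ξ` is locally Lipschitz continuous: on every compact set `K`, there is a
constant `L` with `‖P_γ^{0 ← 1} ξ_y - ξ_x‖ ≤ L dist(x, y)` for all `x, y ∈ K` close to each other,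
`γ` being the short geodesic from `x` to `y`. The vector `P_γ^{0 ← 1} ξ_y` is `W 0`, where `W` is
the parallel field along `γ` with `W 1 = ξ_y`. The length of `γ` is `‖γ'(0)‖`, and below the
injectivity radius of `K` the geodesics of length `< r` that start in `K` are the minimizing
geodesics to the points at distance `< r`. -/
def IsLocallyLipschitzField (ξ : ∀ x : M, TangentSpace 𝓘(ℝ, E) x) : Prop :=
  ∀ K : Set M, IsCompact K → ∃ r : ℝ, 0 < r ∧ ∃ L : ℝ≥0,
    ∀ γ : ℝ → M, IsGeodesic E γ → γ 0 ∈ K → γ 1 ∈ K → ‖velocity (E := E) γ 0‖ < r →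
      ∀ W : ∀ t, TangentSpace 𝓘(ℝ, E) (γ t), IsParallel γ W → W 1 = ξ (γ 1) →
        ‖W 0 - ξ (γ 0)‖ₑ ≤ L * edist (γ 0) (γ 1)

/-! ### Assumptions on the objective -/

variable (E) in
/-- `h` is differentiable and its Riemannian gradient is a locally Lipschitz vector field. -/
def IsLocallyLipschitzDifferentiable (h : M → ℝ) : Prop :=
  MDifferentiable 𝓘(ℝ, E) 𝓘(ℝ, ℝ) h ∧ IsLocallyLipschitzField (grad (E := E) h)

/-- `h` is locally Lipschitz continuous with respect to the retraction `R`. -/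
def IsLocallyLipschitzWrt (R : Retraction E M) (h : M → ℝ) : Prop :=
  ∀ K : Set M, IsCompact K → ∃ L : ℝ, ∀ x ∈ K, ∀ ξ η : TangentSpace 𝓘(ℝ, E) x,
    R x ξ ∈ K → R x η ∈ K → |h (R x ξ) - h (R x η)| ≤ L * ‖ξ - η‖

/-- `h` is `L`-retraction-smooth with respect to `R` in `N`. -/
def IsRetractionSmooth (R : Retraction E M) (h : M → ℝ) (L : ℝ) (N : Set M) : Prop :=
  ∀ x ∈ N, ∀ S : Set (TangentSpace 𝓘(ℝ, E) x), R x '' S ⊆ N → ∀ η ∈ S,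
    h (R x η) ≤ h x + inner ℝ (grad h x) η + L / 2 * ‖η‖ ^ 2

/-- Riemannian Kurdyka–Łojasiewicz property of `h` at `x`, with `ε ∈ (0, ∞]` and desingularising
function `ς` on `[0, ε]` (on `[0, ∞)` if `ε = ∞`). -/
def HasKLAt (R : Retraction E M) (h : M → ℝ) (x : M) : Prop :=
  ∃ ε : EReal, 0 < ε ∧ ∃ U ∈ 𝓝 x, ∃ ς : ℝ → ℝ,
    ContinuousOn ς {t : ℝ | 0 ≤ t ∧ (t : EReal) ≤ ε} ∧
    ConcaveOn ℝ {t : ℝ | 0 ≤ t ∧ (t : EReal) ≤ ε} ς ∧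
    (∀ t : ℝ, 0 ≤ t → (t : EReal) ≤ ε → 0 ≤ ς t) ∧
    ς 0 = 0 ∧
    ContDiffOn ℝ 1 ς {t : ℝ | 0 < t ∧ (t : EReal) < ε} ∧
    (∀ t : ℝ, 0 < t → (t : EReal) < ε → 0 < deriv ς t) ∧
    ∀ y ∈ U, h x < h y → ((h y - h x : ℝ) : EReal) < ε →
      1 ≤ ENNReal.ofReal (deriv ς (h y - h x)) * distZeroSubdiff R h y

/-! ### The algorithm -/

/-- The objective `ℓₓ(η) = ⟨grad f(x), η⟩ + (Lt / 2) ‖η‖² + g (Rₓ η)` of the proximal mapping. -/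
def proxObj (R : Retraction E M) (f g : M → ℝ) (Lt : ℝ) (x : M)
    (η : TangentSpace 𝓘(ℝ, E) x) : ℝ :=
  inner ℝ (grad f x) η + Lt / 2 * ‖η‖ ^ 2 + g (R x η)

/-- `x` is a sequence generated by the inexact Riemannian proximal gradient method with accuracy
function `q`; `ηs k` is a stationary point of the `k`-th proximal mapping and `ηh k` its computed
approximation. -/
structure IsIRPG (R : Retraction E M) (f g : M → ℝ) (Lt : ℝ) (q : ℝ → ℝ → ℝ) (ε : ℕ → ℝ)
    (x : ℕ → M) (ηh ηs : ∀ k, TangentSpace 𝓘(ℝ, E) (x k)) : Prop where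
  eps_pos : ∀ k, 0 < ε k
  stationary : ∀ k, 0 ∈ clarkeSubdiff (proxObj R f g Lt (x k)) (ηs k)
  accuracy : ∀ k, ‖ηh k - ηs k‖ ≤ q (ε k) ‖ηh k‖
  decrease : ∀ k, proxObj R f g Lt (x k) (ηh k) ≤ proxObj R f g Lt (x k) 0
  step : ∀ k, x (k + 1) = R (x k) (ηh k)

end

end IRPG

/-! This is the finite-length argument of Kurdyka–Łojasiewicz type, made tolerant of the inexact
step. Put $F=f+g$ and $\beta=(\tilde L-L)/2$. Retraction-smoothness together with
$\ell_{x_k}(\hat\eta_k)\le\ell_{x_k}(0)$ gives the descent $\beta\|\hat\eta_k\|^2\le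
F(x_k)-F(x_{k+1})$ (`IsIRPG.succ_le`). Hence the iterates stay in the compact sublevel set, $F(x_k)$
converges, and $\hat\eta_k$, $\eta_k^*$ tend to $0$.

A small subgradient is available at $y_k=R_{x_k}(\eta_k^*)$, not at $x_{k+1}$. Near $\eta_k^*$ one
has $R_{x_k}=R_{y_k}\circ\psi$ with $\psi$ strictly differentiable, so a Clarke chain rule moves
stationarity of $\ell_{x_k}$ to $y_k$ (`le_clarkeDirDeriv_of_stationary`). What remains is a
difference of differentials of $f$ at $y_k$ and $x_k$ plus a term linear in $\eta_k^*$, whence a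
subgradient of size $O(\|\eta_k^*\|)$ (`exists_mem_subdiff_norm_le`). This uses a Lipschitz gradient
in coordinates, while the hypothesis speaks of parallel transport along geodesics. Short geodesics
and parallel fields are therefore constructed in a chart by fixed points, and the hypothesis is
tested on them (`exists_transport_estimate`, `exists_lipschitz_chartVecL`).

As $F(y_k)$ and $F(x_{k+1})$ differ by $O(\varepsilon_k^2)$, concavity of $\varsigma$ turns the KL
inequality at $y_k$ into $\beta\|\hat\eta_{k+1}\|^2\le C\varepsilon_k^2+C\|\eta_k^*\|D_k$, where
$D_k$ is a telescoping, hence summable, decrease of $\varsigma$ (`exists_hasStepBound_of_hasKLAt`).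
With $\|\eta_k^*\|\le\|\hat\eta_k\|+\varepsilon_k^2$ and the arithmetic–geometric mean inequality,
$\|\hat\eta_{k+1}\|\le\frac12\|\hat\eta_k\|+{}$summable terms, so $\sum\|\hat\eta_k\|<\infty$
(`summable_of_sq_succ_le`). Steps have length $O(\|\hat\eta_k\|)$; compactness makes the local
constants uniform. Finite length makes the sequence Cauchy, and compactness supplies its limit. -/

namespace IRPG

/-! ### Chain rule for the Clarke directional derivative -/

section Clarke

variable {V W : Type*} [NormedAddCommGroup V] [InnerProductSpace ℝ V]
  [NormedAddCommGroup W] [InnerProductSpace ℝ W]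

/-- One-sided chain and sum rule for the Clarke directional derivative: if `ℓ = h ∘ ψ + s` near `u`
with `ψ`, `s` strictly differentiable and `h` Lipschitz near `ψ u`, then nonnegativity of
`ℓ°(u; v)` gives `-s'(u) v ≤ h°(ψ u; ψ'(u) v)`. -/
lemma neg_le_clarkeDirDeriv_of_comp_add {h : W → ℝ} {ψ : V → W} {s ℓ : V → ℝ} {A : V →L[ℝ] W}
    {S : V →L[ℝ] ℝ} {u : V} (v : V) (hψ : HasStrictFDerivAt ψ A u) (hs : HasStrictFDerivAt s S u)
    {K : ℝ} {U : Set W} (hU : U ∈ 𝓝 (ψ u)) (hh : ∀ a ∈ U, ∀ b ∈ U, |h a - h b| ≤ K * ‖a - b‖)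
    (hℓ : ℓ =ᶠ[𝓝 u] fun ξ => h (ψ ξ) + s ξ) (h0 : 0 ≤ clarkeDirDeriv ℓ u v) :
    ((-(S v) : ℝ) : EReal) ≤ clarkeDirDeriv h (ψ u) (A v) := by
  by_contra! hlt
  obtain ⟨c, hc1, hc2⟩ := EReal.lt_iff_exists_real_btwn.1 hlt
  have hc2 : c < -(S v) := by exact_mod_cast hc2
  set d := -(S v) - c with hd
  have hdpos : 0 < d := by linarith
  -- The linearization errors of `ψ` (multiplied by the Lipschitz constant of `h`) and of `s` must
  -- together use at most half of the gap `d`; the quotients of `ℓ` then stay below `-d / 2`,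
  -- against `h0`.
  obtain ⟨e, he, hed⟩ : ∃ e : ℝ, 0 < e ∧ (|K| + 1) * (e * ‖v‖) ≤ d / 2 := by
    refine ⟨d / 2 / ((|K| + 1) * (‖v‖ + 1)), by positivity, ?_⟩
    have h1 : (|K| + 1) * (d / 2 / ((|K| + 1) * (‖v‖ + 1)) * ‖v‖) = d / 2 * (‖v‖ / (‖v‖ + 1)) := by
      have : |K| + 1 ≠ 0 := by positivity
      have : ‖v‖ + 1 ≠ 0 := by positivity
      field_simp
    rw [h1]
    have : ‖v‖ / (‖v‖ + 1) ≤ 1 := by rw [div_le_one (by positivity)]; linarith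
    nlinarith
  have t1 : Tendsto (fun p : V × ℝ => p.1) (𝓝 u ×ˢ 𝓝[>] (0 : ℝ)) (𝓝 u) := tendsto_fst
  have t0 : Tendsto (fun p : V × ℝ => p.2) (𝓝 u ×ˢ 𝓝[>] (0 : ℝ)) (𝓝 0) :=
    tendsto_snd.mono_right nhdsWithin_le_nhds
  have t2 : Tendsto (fun p : V × ℝ => p.1 + p.2 • v) (𝓝 u ×ˢ 𝓝[>] (0 : ℝ)) (𝓝 u) := by
    simpa using t1.add (t0.smul_const v)
  have t3 : Tendsto (fun p : V × ℝ => (p.1 + p.2 • v, p.1)) (𝓝 u ×ˢ 𝓝[>] (0 : ℝ)) (𝓝 (u, u)) :=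
    t2.prodMk_nhds t1
  have hψc : Tendsto ψ (𝓝 u) (𝓝 (ψ u)) := hψ.hasFDerivAt.continuousAt
  have t4 : Tendsto (fun p : V × ℝ => (ψ p.1, p.2)) (𝓝 u ×ˢ 𝓝[>] (0 : ℝ))
      (𝓝 (ψ u) ×ˢ 𝓝[>] (0 : ℝ)) := (hψc.comp t1).prodMk tendsto_snd
  have t5 : Tendsto (fun p : V × ℝ => ψ p.1 + p.2 • A v) (𝓝 u ×ˢ 𝓝[>] (0 : ℝ)) (𝓝 (ψ u)) := by
    simpa using (hψc.comp t1).add (t0.smul_const (A v))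
  have e1 := t4.eventually (eventually_lt_of_limsup_lt hc1)
  have e2 := t3.eventually (hψ.isLittleO.bound he)
  have e3 := t3.eventually (hs.isLittleO.bound he)
  have e6 : ∀ᶠ p : V × ℝ in 𝓝 u ×ˢ 𝓝[>] (0 : ℝ), 0 < p.2 :=
    tendsto_snd.eventually self_mem_nhdsWithin
  have key : clarkeDirDeriv ℓ u v ≤ ((-(d / 2) : ℝ) : EReal) := by
    refine limsup_le_of_le (by isBoundedDefault) ?_
    filter_upwards [e1, e2, e3, t5.eventually hU, (hψc.comp t2).eventually hU, e6,
      t1.eventually hℓ, t2.eventually hℓ] with p h1 h2 h3 h5 h5' h6 h7 h8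
    have h1 : (h (ψ p.1 + p.2 • A v) - h (ψ p.1)) / p.2 < c := by exact_mod_cast h1
    rw [div_lt_iff₀ h6] at h1
    rw [h7, h8]
    norm_cast
    rw [div_le_iff₀ h6]
    simp only [add_sub_cancel_left, map_smul, norm_smul, Real.norm_eq_abs, abs_of_pos h6,
      smul_eq_mul] at h2 h3
    have h9 := hh _ h5' _ h5
    simp only [Function.comp_apply] at h9
    have h10 : ‖ψ (p.1 + p.2 • v) - (ψ p.1 + p.2 • A v)‖ ≤ e * (p.2 * ‖v‖) := by
      rwa [← sub_sub]
    have h11 : K * ‖ψ (p.1 + p.2 • v) - (ψ p.1 + p.2 • A v)‖ ≤ |K| * (e * (p.2 * ‖v‖)) :=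
      mul_le_mul (le_abs_self K) h10 (norm_nonneg _) (abs_nonneg K)
    have h12 := mul_le_mul_of_nonneg_right hed h6.le
    have h13 := (abs_le.1 (h9.trans h11)).2
    have h14 := (abs_le.1 h3).2
    nlinarith
  have : (0 : EReal) ≤ ((-(d / 2) : ℝ) : EReal) := h0.trans key
  have : (0 : ℝ) ≤ -(d / 2) := by exact_mod_cast this
  linarith

/-- The one-sided chain rule for `ℓ = h ∘ ψ + ⟪a, ·⟫ + (c / 2) ‖·‖² - k`. -/
lemma le_clarkeDirDeriv_of_prox {h : W → ℝ} {ψ : V → W} {k ℓ : V → ℝ} {A : V →L[ℝ] W}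
    {D : V →L[ℝ] ℝ} {a u : V} {w₀ : W} {c : ℝ} (v : V) (hψ : HasStrictFDerivAt ψ A u)
    (hψ₀ : ψ u = w₀) (hk : HasStrictFDerivAt k D u) {K : ℝ} {U : Set W} (hU : U ∈ 𝓝 w₀)
    (hh : ∀ a ∈ U, ∀ b ∈ U, |h a - h b| ≤ K * ‖a - b‖)
    (hℓ : ∀ᶠ ξ in 𝓝 u, ℓ ξ = h (ψ ξ) + (inner ℝ a ξ + c / 2 * ‖ξ‖ ^ 2 - k ξ))
    (h0 : 0 ≤ clarkeDirDeriv ℓ u v) :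
    ((D v - inner ℝ a v - c * inner ℝ u v : ℝ) : EReal) ≤ clarkeDirDeriv h w₀ (A v) := by
  subst hψ₀
  have h1 : HasStrictFDerivAt (fun ξ => inner ℝ a ξ) (innerSL ℝ a) u :=
    (innerSL ℝ a).hasStrictFDerivAt
  have h2 : HasStrictFDerivAt (fun ξ : V => c / 2 * ‖ξ‖ ^ 2) ((c / 2) • (2 • innerSL ℝ u)) u :=
    (hasStrictFDerivAt_norm_sq u).const_mul (c / 2)
  refine le_of_eq_of_le ?_
    (neg_le_clarkeDirDeriv_of_comp_add v hψ ((h1.fun_add h2).fun_sub hk) hU hh hℓ h0)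
  congr 1
  simp
  ring

end Clarke

/-! ### Real sequences -/

/-- Summing the recursion bounds a partial sum by a constant plus half of itself, and that half is
absorbed on the left. -/
lemma summable_of_succ_le_half_add {n e : ℕ → ℝ} (hn : ∀ k, 0 ≤ n k) (he0 : ∀ k, 0 ≤ e k)
    (he : Summable e) (h : ∀ k, n (k + 1) ≤ n k / 2 + e k) : Summable n := by
  refine summable_of_sum_range_le (c := 2 * (n 0 + ∑' k, e k)) hn fun m => ?_
  have h1 : ∑ k ∈ Finset.range (m + 1), n k ≤
      n 0 + (∑ k ∈ Finset.range m, n k) / 2 + ∑ k ∈ Finset.range m, e k := by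
    rw [Finset.sum_range_succ', Finset.sum_div, add_assoc, ← Finset.sum_add_distrib, add_comm]
    gcongr with k hk
    exact h k
  have h2 := he.sum_le_tsum (Finset.range m) (fun k _ => he0 k)
  have h3 : ∑ k ∈ Finset.range m, n k ≤ ∑ k ∈ Finset.range (m + 1), n k :=
    Finset.sum_le_sum_of_subset_of_nonneg (by simp) (fun k _ _ => hn k)
  linarith

/-- The product `m k * D k` is split by the arithmetic–geometric mean inequality so that `m k`
enters with coefficient `1 / 2`. Replacing `m k` by `n k + e k ^ 2` then leaves a contraction with a
summable perturbation. -/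
lemma summable_of_sq_succ_le {n m e D : ℕ → ℝ} {A β C : ℝ} (hβ : 0 < β) (hA : 0 ≤ A) (hC : 0 ≤ C)
    (hn : ∀ k, 0 ≤ n k) (hm : ∀ k, 0 ≤ m k) (he0 : ∀ k, 0 ≤ e k) (hD0 : ∀ k, 0 ≤ D k)
    (he : Summable e) (hD : Summable D) (hmn : ∀ k, m k ≤ n k + e k ^ 2)
    (h : ∀ k, β * n (k + 1) ^ 2 ≤ A * e k ^ 2 + C * m k * D k) : Summable n := by
  have he2 : Summable fun k => e k ^ 2 := by
    have h1 : ∀ᶠ k in atTop, e k ≤ 1 :=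
      (he.tendsto_atTop_zero.eventually (gt_mem_nhds zero_lt_one)).mono fun _ h => le_of_lt h
    refine Summable.of_norm_bounded_eventually_nat he (h1.mono fun k hk => ?_)
    rw [Real.norm_of_nonneg (by positivity)]
    nlinarith [he0 k]
  refine summable_of_succ_le_half_add (e := fun k => e k ^ 2 / 2 + (A / β + 1) * e k + C / β * D k)
    hn (fun k => ?_) (((he2.div_const 2).add (he.mul_left _)).add (hD.mul_left _)) fun k => ?_
  · have := he0 k
    have := hD0 k
    positivity
  -- In the square of the right-hand side the cross term of `m k / 2` and `C / β * D k` is exactly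
  -- `C / β * m k * D k`; the coefficient `A / β + 1` is used because its square dominates `A / β`.
  · have h1 : n (k + 1) ≤ m k / 2 + (A / β + 1) * e k + C / β * D k := by
      have hX : 0 ≤ m k / 2 + (A / β + 1) * e k + C / β * D k := by
        have := he0 k
        have := hD0 k
        have := hm k
        positivity
      refine le_of_sq_le_sq ?_ hX
      have h2 : n (k + 1) ^ 2 ≤ A / β * e k ^ 2 + C / β * m k * D k := by
        have : n (k + 1) ^ 2 ≤ (A * e k ^ 2 + C * m k * D k) / β := by
          rw [le_div_iff₀ hβ, mul_comm]; exact h k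
        calc _ ≤ _ := this
          _ = _ := by ring
      have p1 : 0 ≤ A / β := by positivity
      have p2 : 0 ≤ C / β * D k := by have := hD0 k; positivity
      have p3 := he0 k
      have p4 := hm k
      have p5 : 0 ≤ (A / β + 1) * e k := by positivity
      have p6 : A / β * e k ^ 2 ≤ ((A / β + 1) * e k) ^ 2 := by
        rw [mul_pow]
        gcongr
        nlinarith
      nlinarith [mul_nonneg p5 p4, mul_nonneg p5 p2, mul_nonneg p4 p2]
    have := hmn k
    linarith

/-! ### Desingularising functions -/

section Concave

variable {ε : EReal} {ς : ℝ → ℝ}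

/-- For a concave function the derivative at `b` is at most the slope of any chord that ends at or
before `b`. The point of differentiation `b` is kept separate from `t` because the KL inequality is
known at a value other than those whose decrease is measured. -/
lemma deriv_mul_le_sub_of_concave
    (hc : ConcaveOn ℝ {t : ℝ | 0 ≤ t ∧ (t : EReal) ≤ ε} ς)
    (hd : ∀ t : ℝ, 0 < t → (t : EReal) < ε → 0 < deriv ς t)
    {a t b : ℝ} (ha : 0 ≤ a) (hat : a < t) (htb : t ≤ b) (hb : (b : EReal) < ε) :
    deriv ς b * (t - a) ≤ ς t - ς a := by
  have hle : ∀ r : ℝ, r ≤ b → (r : EReal) ≤ ε := fun r hr =>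
    (EReal.coe_le_coe_iff.2 hr).trans hb.le
  have hb0 : 0 < b := ha.trans_lt (hat.trans_le htb)
  have hdiff : DifferentiableAt ℝ ς b := differentiableAt_of_deriv_ne_zero (hd b hb0 hb).ne'
  have h1 : deriv ς b ≤ slope ς a b :=
    hc.deriv_le_slope ⟨ha, hle a (hat.le.trans htb)⟩ ⟨hb0.le, hb.le⟩ (hat.trans_le htb) hdiff
  have h2 : slope ς a b ≤ slope ς a t :=
    hc.slope_anti ⟨ha, hle a (hat.le.trans htb)⟩
      ⟨⟨ha.trans hat.le, hle t htb⟩, by simpa using hat.ne'⟩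
      ⟨⟨hb0.le, hb.le⟩, by simpa using (hat.trans_le htb).ne'⟩ htb
  have h3 := h1.trans h2
  rwa [slope_def_field, le_div_iff₀ (sub_pos.2 hat)] at h3

lemma le_of_concave_of_deriv_pos
    (hc : ConcaveOn ℝ {t : ℝ | 0 ≤ t ∧ (t : EReal) ≤ ε} ς)
    (hd : ∀ t : ℝ, 0 < t → (t : EReal) < ε → 0 < deriv ς t)
    {a t : ℝ} (ha : 0 ≤ a) (hat : a ≤ t) (ht : (t : EReal) < ε) : ς a ≤ ς t := by
  rcases hat.eq_or_lt with rfl | hat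
  · rfl
  · have := deriv_mul_le_sub_of_concave hc hd ha hat le_rfl ht
    have := mul_pos (hd t (ha.trans_lt hat) ht) (sub_pos.2 hat)
    linarith

/-- A decrease of the argument is controlled by the decrease of a desingularising function `ς`,
given the Kurdyka–Łojasiewicz inequality at a value `b` close to `a`. -/
lemma sub_le_add_mul_sub_of_concave
    (hc : ConcaveOn ℝ {t : ℝ | 0 ≤ t ∧ (t : EReal) ≤ ε} ς)
    (hd : ∀ t : ℝ, 0 < t → (t : EReal) < ε → 0 < deriv ς t)
    {a a' b X m : ℝ} (ha' : 0 ≤ a') (haa : a' ≤ a) (ha : (a : EReal) < ε) (hb : (b : EReal) < ε)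
    (hX : |b - a| ≤ X) (hm : 0 ≤ m) (hKL : 0 < b → 1 ≤ deriv ς b * m) :
    a - a' ≤ X + m * (ς a - ς a') := by
  have hX' := abs_le.1 hX
  have hmono : 0 ≤ m * (ς a - ς a') :=
    mul_nonneg hm (sub_nonneg.2 (le_of_concave_of_deriv_pos hc hd ha' haa ha))
  rcases le_or_gt b a' with hba | hba
  · linarith
  rcases haa.eq_or_lt with rfl | haa
  · linarith
  -- Only a chord to the left of `b` can be compared with `deriv ς b`, so the decrease is measured
  -- from `min a b`; the remaining part `a - min a b` is at most `X`.
  have ht : a' < min a b := lt_min haa hba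
  have h1 := deriv_mul_le_sub_of_concave hc hd ha' ht (min_le_right a b) hb
  have h2 : ς (min a b) ≤ ς a :=
    le_of_concave_of_deriv_pos hc hd (ha'.trans ht.le) (min_le_left a b) ha
  have h3 := hKL (ha'.trans_lt hba)
  have h4 : m * (deriv ς b * (min a b - a')) ≤ m * (ς a - ς a') :=
    mul_le_mul_of_nonneg_left (h1.trans (by linarith)) hm
  have h5 : min a b - a' ≤ m * (deriv ς b * (min a b - a')) := by
    nlinarith [mul_le_mul_of_nonneg_right h3 (sub_pos.2 ht).le]
  have h6 : a - X ≤ min a b := le_min (by linarith) (by linarith)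
  linarith

end Concave

/-! ### Boundary value problems for the geodesic and parallel transport equations -/

section ODE

lemma exists_fixedPoint_of_dist_le_half {X : Type*} [MetricSpace X] [CompleteSpace X] {s : Set X}
    (hs : IsClosed s) (hne : s.Nonempty) {T : X → X} (hT : MapsTo T s s)
    (h : ∀ x ∈ s, ∀ y ∈ s, dist (T x) (T y) ≤ dist x y / 2) : ∃ x ∈ s, T x = x := by
  obtain ⟨x, hx⟩ := hne
  have hc : ContractingWith (1 / 2 : ℝ≥0) (hT.restrict T s s) := by
    refine ⟨by norm_num, LipschitzWith.of_dist_le_mul fun x y => ?_⟩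
    have := h x x.2 y y.2
    simp only [Subtype.dist_eq, MapsTo.val_restrict_apply]
    push_cast
    linarith
  obtain ⟨y, hy, hfix, -⟩ := hc.exists_fixedPoint' hs.isComplete hT hx (edist_ne_top _ _)
  exact ⟨y, hy, hfix⟩

variable {E : Type*} [NormedAddCommGroup E]

/-- The extension of a path on the unit interval that is constant outside of it. -/
noncomputable abbrev pathExtend (u : C(unitInterval, E)) : ℝ → E := IccExtend zero_le_one u

lemma continuous_pathExtend (u : C(unitInterval, E)) : Continuous (pathExtend u) :=
  u.continuous.Icc_extend'

lemma norm_pathExtend_le (u : C(unitInterval, E)) (s : ℝ) : ‖pathExtend u s‖ ≤ ‖u‖ :=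
  u.norm_coe_le_norm _

lemma norm_pathExtend_sub_le (u u' : C(unitInterval, E)) (s : ℝ) :
    ‖pathExtend u s - pathExtend u' s‖ ≤ dist u u' := by
  rw [← dist_eq_norm]
  exact ContinuousMap.dist_apply_le_dist _

variable [NormedSpace ℝ E]

lemma norm_integral_le_of_Icc {f : ℝ → E} {B a b : ℝ} (hB : 0 ≤ B) (ha : a ∈ Icc (0 : ℝ) 1)
    (hb : b ∈ Icc (0 : ℝ) 1) (hf : ∀ s ∈ Icc (0 : ℝ) 1, ‖f s‖ ≤ B) : ‖∫ s in a..b, f s‖ ≤ B := by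
  have h1 : ‖∫ s in a..b, f s‖ ≤ B * |b - a| := by
    refine intervalIntegral.norm_integral_le_of_norm_le_const fun s hs => hf s ?_
    exact uIcc_subset_Icc ha hb (uIoc_subset_uIcc hs)
  have h2 : |b - a| ≤ 1 := by
    rw [abs_le]; constructor <;> linarith [ha.1, ha.2, hb.1, hb.2]
  nlinarith

variable [CompleteSpace E]

/-- Picard iteration for `v' = -A v` from the end time `1`, where the transported vector is
prescribed. The smallness of `A` makes the integral operator a contraction on the whole path space,
and the fixed point has norm at most `2 * ‖v₁‖`, which gives the displacement bound. -/
lemma exists_linear_transport {A : ℝ → E →L[ℝ] E} (hA : Continuous A) {θ : ℝ}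
    (hθ : ∀ t ∈ Icc (0 : ℝ) 1, ‖A t‖ ≤ θ) (hθ2 : θ ≤ 1 / 2) (v₁ : E) :
    ∃ v : ℝ → E, v 1 = v₁ ∧
      (∀ t ∈ Icc (0 : ℝ) 1, HasDerivWithinAt v (-(A t (v t))) (Icc 0 1) t) ∧
      ∀ t ∈ Icc (0 : ℝ) 1, ‖v t - v₁‖ ≤ 2 * θ * ‖v₁‖ := by
  have hθ0 : 0 ≤ θ := (norm_nonneg _).trans (hθ 0 (by simp))
  have hcont : ∀ u : C(unitInterval, E), Continuous fun s => A s (pathExtend u s) := fun u =>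
    hA.clm_apply (continuous_pathExtend u)
  let T : C(unitInterval, E) → C(unitInterval, E) := fun u =>
    ⟨fun t => v₁ - ∫ s in (1 : ℝ)..t, A s (pathExtend u s), by
      have := (intervalIntegral.differentiable_integral_of_continuous
        (f := fun s => A s (pathExtend u s)) (a := 1) (hcont u)).continuous
      fun_prop⟩
  have hT : ∀ u t, T u t = v₁ - ∫ s in (1 : ℝ)..t, A s (pathExtend u s) := fun _ _ => rfl
  obtain ⟨u, -, hu⟩ : ∃ u ∈ univ, T u = u := by
    refine exists_fixedPoint_of_dist_le_half isClosed_univ univ_nonempty (mapsTo_univ _ _)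
      fun u _ u' _ => ?_
    rw [ContinuousMap.dist_le (by positivity)]
    intro t
    rw [dist_eq_norm, hT, hT, sub_sub_sub_cancel_left, ← intervalIntegral.integral_sub
      ((hcont u').intervalIntegrable _ _) ((hcont u).intervalIntegrable _ _)]
    refine norm_integral_le_of_Icc (by positivity) (by simp) t.2 fun s hs => ?_
    rw [← map_sub]
    refine (ContinuousLinearMap.le_opNorm _ _).trans ?_
    have h1 := norm_pathExtend_sub_le u' u s
    rw [dist_comm] at h1
    nlinarith [hθ s hs, norm_nonneg (A s), norm_nonneg (pathExtend u' s - pathExtend u s)]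
  have hval : ∀ t ∈ Icc (0 : ℝ) 1, pathExtend u t = v₁ - ∫ s in (1 : ℝ)..t, A s (pathExtend u s) := by
    intro t ht
    rw [← hT u ⟨t, ht⟩, hu]
    exact IccExtend_of_mem _ _ ht
  have hsub : ∀ t ∈ Icc (0 : ℝ) 1, ‖pathExtend u t - v₁‖ ≤ θ * ‖u‖ := by
    intro t ht
    rw [hval t ht, sub_sub_cancel_left, norm_neg]
    refine norm_integral_le_of_Icc (by positivity) (by simp) ht fun s hs => ?_
    refine (ContinuousLinearMap.le_opNorm _ _).trans ?_
    exact mul_le_mul (hθ s hs) (norm_pathExtend_le u s) (norm_nonneg _) hθ0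
  have hnorm : ‖u‖ ≤ ‖v₁‖ + θ * ‖u‖ := by
    rw [ContinuousMap.norm_le _ (by positivity)]
    intro t
    have h1 := hsub t t.2
    rw [pathExtend, IccExtend_val] at h1
    have h2 := norm_le_norm_add_norm_sub' (u t) v₁
    linarith
  have hnorm2 : ‖u‖ ≤ 2 * ‖v₁‖ := by nlinarith [norm_nonneg u]
  refine ⟨pathExtend u, ?_, fun t ht => ?_, fun t ht => (hsub t ht).trans (by nlinarith)⟩
  · rw [hval 1 (by simp), intervalIntegral.integral_same, sub_zero]
  · have h1 : HasDerivAt (fun t => v₁ - ∫ s in (1 : ℝ)..t, A s (pathExtend u s))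
        (-(A t (pathExtend u t))) t :=
      (intervalIntegral.integral_hasDerivAt_right ((hcont u).intervalIntegrable _ _)
        ((hcont u).stronglyMeasurableAtFilter _ _) (hcont u).continuousAt).const_sub v₁
    exact h1.hasDerivWithinAt.congr hval (hval t ht)

set_option synthInstance.maxHeartbeats 200000 in
/-- Points `z₁, z₂` that are close to each other are joined by a solution of the geodesic equation
`c'' + Γ(c)(c', c') = 0`. -/
lemma exists_geodesic_equation_solution {Γ : E → E →L[ℝ] E →L[ℝ] E} {K : ℝ≥0} {C : ℝ}
    (hK : LipschitzWith K Γ) (hC : ∀ z, ‖Γ z‖ ≤ C) {z₁ z₂ : E}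
    (hz : ‖z₂ - z₁‖ ≤ 1 / (16 * (K + C) + 1)) :
    ∃ c u : ℝ → E, c 0 = z₁ ∧ c 1 = z₂ ∧ Continuous u ∧ (∀ t, HasDerivAt c (u t) t) ∧
      (∀ t, ‖u t‖ ≤ 2 * ‖z₂ - z₁‖) ∧
      ∀ t ∈ Icc (0 : ℝ) 1, HasDerivWithinAt u (-(Γ (c t) (u t) (u t))) (Icc 0 1) t := by
  have hC0 : 0 ≤ C := (norm_nonneg (Γ 0)).trans (hC 0)
  have hK0 : (0 : ℝ) ≤ K := K.2
  set a := z₂ - z₁ with ha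
  -- Two facts are drawn from this: `(K + C) * ‖a‖ ≤ 1 / 16`, and `‖a‖ ≤ 1`, which is what the `+ 1`
  -- in the denominator provides.
  have ha1 : 16 * (K + C) * ‖a‖ + ‖a‖ ≤ 1 := by
    rw [le_div_iff₀ (by positivity)] at hz
    linarith
  have haK : 0 ≤ K * ‖a‖ := by positivity
  have haC : 0 ≤ C * ‖a‖ := by positivity
  have ha0 := norm_nonneg a
  let c : C(unitInterval, E) → ℝ → E := fun u t => z₁ + ∫ s in (0 : ℝ)..t, pathExtend u s
  have hcd : ∀ u t, HasDerivAt (c u) (pathExtend u t) t := fun u t =>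
    (intervalIntegral.integral_hasDerivAt_right
      ((continuous_pathExtend u).intervalIntegrable _ _)
      ((continuous_pathExtend u).stronglyMeasurableAtFilter _ _)
      (continuous_pathExtend u).continuousAt).const_add z₁
  have hcc : ∀ u, Continuous (c u) := fun u =>
    continuous_iff_continuousAt.2 fun t => (hcd u t).continuousAt
  let N : C(unitInterval, E) → ℝ → E := fun u s => Γ (c u s) (pathExtend u s) (pathExtend u s)
  have hN : ∀ u, Continuous (N u) := fun u =>
    ((hK.continuous.comp (hcc u)).clm_apply (continuous_pathExtend u)).clm_apply
      (continuous_pathExtend u)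
  let q : C(unitInterval, E) → ℝ → E := fun u t => ∫ s in (0 : ℝ)..t, N u s
  have hqd : ∀ u t, HasDerivAt (q u) (N u t) t := fun u t =>
    intervalIntegral.integral_hasDerivAt_right ((hN u).intervalIntegrable _ _)
      ((hN u).stronglyMeasurableAtFilter _ _) (hN u).continuousAt
  have hqc : ∀ u, Continuous (q u) := fun u =>
    continuous_iff_continuousAt.2 fun t => (hqd u t).continuousAt
  -- The unknown is the velocity `u`. A fixed point satisfies `u' = -Γ(c)(u, u)`, and the additive
  -- constant is the one that forces the mean of `u` to be `a`, so that the curve ends at `z₂`.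
  let T : C(unitInterval, E) → C(unitInterval, E) := fun u =>
    ⟨fun t => a - q u t + ∫ τ in (0 : ℝ)..1, q u τ, by have := hqc u; fun_prop⟩
  have hT : ∀ u t, T u t = a - q u t + ∫ τ in (0 : ℝ)..1, q u τ := fun _ _ => rfl
  have h01 : (0 : ℝ) ∈ Icc (0 : ℝ) 1 := by simp
  have h11 : (1 : ℝ) ∈ Icc (0 : ℝ) 1 := by simp
  -- On this ball the quadratic term is at most `‖a‖ / 4` and its variation at most a quarter of the
  -- distance. It enters `T` twice, through `q u t` and through the mean of `q u`.
  obtain ⟨u, hu2, hu⟩ : ∃ u ∈ Metric.closedBall (0 : C(unitInterval, E)) (2 * ‖a‖), T u = u := by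
    refine exists_fixedPoint_of_dist_le_half Metric.isClosed_closedBall
      ⟨0, by simp⟩ (fun u hu => ?_) fun u hu u' hu' => ?_
    · rw [mem_closedBall_zero_iff] at hu ⊢
      have hNb : ∀ s ∈ Icc (0 : ℝ) 1, ‖N u s‖ ≤ ‖a‖ / 4 := by
        intro s _
        calc ‖N u s‖ ≤ ‖Γ (c u s)‖ * ‖pathExtend u s‖ * ‖pathExtend u s‖ :=
              ContinuousLinearMap.le_opNorm₂ _ _ _
          _ ≤ C * (2 * ‖a‖) * (2 * ‖a‖) := by
              have := (norm_pathExtend_le u s).trans hu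
              gcongr
              exact hC _
          _ ≤ ‖a‖ / 4 := by nlinarith
      have hqb : ∀ s ∈ Icc (0 : ℝ) 1, ‖q u s‖ ≤ ‖a‖ / 4 := fun s hs =>
        norm_integral_le_of_Icc (by positivity) h01 hs hNb
      rw [ContinuousMap.norm_le _ (by positivity)]
      intro t
      rw [hT]
      have h1 := hqb t t.2
      have h2 := norm_integral_le_of_Icc (f := q u) (by positivity) h01 h11 hqb
      have h3 := norm_add_le (a - q u t) (∫ τ in (0 : ℝ)..1, q u τ)
      have h4 := norm_sub_le a (q u t)
      linarith
    · rw [mem_closedBall_zero_iff] at hu hu'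
      have hd0 : 0 ≤ dist u u' := dist_nonneg
      have hcb : ∀ s ∈ Icc (0 : ℝ) 1, ‖c u s - c u' s‖ ≤ dist u u' := by
        intro s hs
        simp only [c]
        rw [add_sub_add_left_eq_sub, ← intervalIntegral.integral_sub
          ((continuous_pathExtend u).intervalIntegrable _ _)
          ((continuous_pathExtend u').intervalIntegrable _ _)]
        exact norm_integral_le_of_Icc dist_nonneg h01 hs fun r _ => norm_pathExtend_sub_le u u' r
      have hNb : ∀ s ∈ Icc (0 : ℝ) 1, ‖N u s - N u' s‖ ≤ dist u u' / 4 := by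
        intro s hs
        set U := pathExtend u s with hU
        set U' := pathExtend u' s with hU'
        have e : N u s - N u' s = (Γ (c u s) - Γ (c u' s)) U U + Γ (c u' s) (U - U') U
            + Γ (c u' s) U' (U - U') := by
          simp only [N, map_sub, sub_apply, ← hU, ← hU']
          abel
        have b1 : ‖U‖ ≤ 2 * ‖a‖ := (norm_pathExtend_le u s).trans hu
        have b2 : ‖U'‖ ≤ 2 * ‖a‖ := (norm_pathExtend_le u' s).trans hu'
        have b3 : ‖U - U'‖ ≤ dist u u' := norm_pathExtend_sub_le u u' s
        have b4 : ‖Γ (c u s) - Γ (c u' s)‖ ≤ K * dist u u' := by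
          refine (hK.norm_sub_le _ _).trans ?_
          gcongr
          exact hcb s hs
        calc ‖N u s - N u' s‖ ≤ ‖(Γ (c u s) - Γ (c u' s)) U U‖ + ‖Γ (c u' s) (U - U') U‖
              + ‖Γ (c u' s) U' (U - U')‖ := by rw [e]; exact norm_add₃_le
          _ ≤ (K * dist u u') * (2 * ‖a‖) * (2 * ‖a‖) + C * dist u u' * (2 * ‖a‖)
              + C * (2 * ‖a‖) * dist u u' := by
              gcongr
              · refine (ContinuousLinearMap.le_opNorm₂ _ _ _).trans ?_
                gcongr
              · refine (ContinuousLinearMap.le_opNorm₂ _ _ _).trans ?_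
                gcongr
                exact hC _
              · refine (ContinuousLinearMap.le_opNorm₂ _ _ _).trans ?_
                gcongr
                exact hC _
          _ = (4 * (K * ‖a‖) * ‖a‖ + 4 * (C * ‖a‖)) * dist u u' := by ring
          _ ≤ 1 / 4 * dist u u' := by
              gcongr
              nlinarith
          _ = dist u u' / 4 := by ring
      have hqb : ∀ s ∈ Icc (0 : ℝ) 1, ‖q u s - q u' s‖ ≤ dist u u' / 4 := by
        intro s hs
        simp only [q]
        rw [← intervalIntegral.integral_sub
          ((hN u).intervalIntegrable _ _) ((hN u').intervalIntegrable _ _)]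
        exact norm_integral_le_of_Icc (by positivity) h01 hs hNb
      rw [ContinuousMap.dist_le (by positivity)]
      intro t
      have h2 := norm_integral_le_of_Icc (by positivity) h01 h11 hqb
      rw [intervalIntegral.integral_sub
          ((hqc u).intervalIntegrable _ _) ((hqc u').intervalIntegrable _ _)] at h2
      rw [dist_eq_norm, hT, hT]
      have e : a - q u t + (∫ τ in (0 : ℝ)..1, q u τ) - (a - q u' t + ∫ τ in (0 : ℝ)..1, q u' τ)
          = -(q u t - q u' t) + ((∫ τ in (0 : ℝ)..1, q u τ) - ∫ τ in (0 : ℝ)..1, q u' τ) := by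
        abel
      rw [e]
      have h3 := norm_add_le (-(q u t - q u' t))
        ((∫ τ in (0 : ℝ)..1, q u τ) - ∫ τ in (0 : ℝ)..1, q u' τ)
      rw [norm_neg] at h3
      have h4 := hqb t t.2
      linarith
  rw [mem_closedBall_zero_iff] at hu2
  have hval : ∀ t ∈ Icc (0 : ℝ) 1, pathExtend u t = a - q u t + ∫ τ in (0 : ℝ)..1, q u τ := by
    intro t ht
    rw [← hT u ⟨t, ht⟩, hu]
    exact IccExtend_of_mem _ _ ht
  refine ⟨c u, pathExtend u, by simp [c], ?_, continuous_pathExtend u, hcd u,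
    fun t => (norm_pathExtend_le u t).trans hu2, fun t ht => ?_⟩
  · have h1 : ∫ s in (0 : ℝ)..1, pathExtend u s
        = ∫ s in (0 : ℝ)..1, ((a - q u s) + ∫ τ in (0 : ℝ)..1, q u τ) :=
      intervalIntegral.integral_congr fun s hs => hval s (by simpa using hs)
    have h2 : ∫ s in (0 : ℝ)..1, ((a - q u s) + ∫ τ in (0 : ℝ)..1, q u τ) = a := by
      have i1 : IntervalIntegrable (fun s => a - q u s) MeasureTheory.volume 0 1 :=
        (continuous_const.sub (hqc u)).intervalIntegrable _ _
      rw [intervalIntegral.integral_add i1 intervalIntegrable_const,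
        intervalIntegral.integral_sub intervalIntegrable_const ((hqc u).intervalIntegrable _ _)]
      simp
    simp only [c]
    rw [h1, h2, ha]
    abel
  · have h1 : HasDerivAt (fun t => a - q u t + ∫ τ in (0 : ℝ)..1, q u τ) (-(N u t)) t :=
      ((hqd u t).const_sub a).add_const _
    exact h1.hasDerivWithinAt.congr hval (hval t ht)

end ODE

/-! ### Tangent vectors, retractions and the metric in a chart -/

set_option linter.unusedSectionVars false
noncomputable section Coordinates

variable {E : Type*} [NormedAddCommGroup E] [NormedSpace ℝ E] [FiniteDimensional ℝ E]
  {M : Type*} [EMetricSpace M] [ChartedSpace E M] [IsManifold 𝓘(ℝ, E) ∞ M]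
  [RiemannianBundle (fun x : M => TangentSpace 𝓘(ℝ, E) x)]

/-- The tangent vector at the point with coordinates `z` in the chart around `p` whose coordinates
are `u`. -/
def vecAt (p : M) (z : E) : E →L[ℝ] TangentSpace 𝓘(ℝ, E) ((extChartAt 𝓘(ℝ, E) p).symm z) :=
  mfderiv 𝓘(ℝ, E) 𝓘(ℝ, E) (extChartAt 𝓘(ℝ, E) p).symm z

/-- `chartVec` as a continuous linear map. -/
def chartVecL (p y : M) : TangentSpace 𝓘(ℝ, E) y →L[ℝ] E :=
  mvfderiv 𝓘(ℝ, E) (extChartAt 𝓘(ℝ, E) p) y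

lemma chartVecL_apply (p y : M) (v : TangentSpace 𝓘(ℝ, E) y) : chartVecL p y v = chartVec p y v := rfl

lemma isOpen_target (p : M) : IsOpen (extChartAt 𝓘(ℝ, E) p).target := isOpen_extChartAt_target p

variable {p : M} {z : E}

lemma chart_symm_mem_source (hz : z ∈ (extChartAt 𝓘(ℝ, E) p).target) :
    (extChartAt 𝓘(ℝ, E) p).symm z ∈ (chartAt E p).source := by
  have := (extChartAt 𝓘(ℝ, E) p).map_target hz
  rwa [extChartAt_source] at this

lemma chartVecL_vecAt (hz : z ∈ (extChartAt 𝓘(ℝ, E) p).target) (u : E) :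
    chartVecL p ((extChartAt 𝓘(ℝ, E) p).symm z) (vecAt p z u) = u := by
  have := mfderiv_extChartAt_comp_mfderivWithin_extChartAt_symm (I := 𝓘(ℝ, E)) hz
  have h2 := DFunLike.congr_fun this u
  simp only [modelWithCornersSelf_coe, range_id, mfderivWithin_univ] at h2
  exact h2

lemma vecAt_chartVecL (hz : z ∈ (extChartAt 𝓘(ℝ, E) p).target)
    (v : TangentSpace 𝓘(ℝ, E) ((extChartAt 𝓘(ℝ, E) p).symm z)) :
    vecAt p z (chartVecL p ((extChartAt 𝓘(ℝ, E) p).symm z) v) = v := by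
  have := mfderivWithin_extChartAt_symm_comp_mfderiv_extChartAt (I := 𝓘(ℝ, E)) hz
  have h2 := DFunLike.congr_fun this v
  simp only [modelWithCornersSelf_coe, range_id, mfderivWithin_univ] at h2
  exact h2

/-- The link with the trivialization of the tangent bundle, from which smoothness and norm bounds
are inherited. -/
lemma vecAt_eq_symmL (hz : z ∈ (extChartAt 𝓘(ℝ, E) p).target) (u : E) :
    vecAt p z u = (trivializationAt E (TangentSpace 𝓘(ℝ, E)) p).symmL ℝ
      ((extChartAt 𝓘(ℝ, E) p).symm z) u := by
  have h := TangentBundle.symmL_trivializationAt (𝕜 := ℝ) (I := 𝓘(ℝ, E))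
    (chart_symm_mem_source hz)
  have h2 := DFunLike.congr_fun h u
  simp only [modelWithCornersSelf_coe, range_id, mfderivWithin_univ] at h2
  rw [(extChartAt 𝓘(ℝ, E) p).right_inv hz] at h2
  exact h2.symm

/-- Read in the trivialization at `p`, the fiber component of this map is the projection `(z, u) ↦
u`. -/
lemma contMDiffOn_vecAt (p : M) :
    ContMDiffOn 𝓘(ℝ, E × E) 𝓘(ℝ, E).tangent ∞
      (fun q : E × E => (⟨(extChartAt 𝓘(ℝ, E) p).symm q.1, vecAt p q.1 q.2⟩ :
        TangentBundle 𝓘(ℝ, E) M)) ((extChartAt 𝓘(ℝ, E) p).target ×ˢ univ) := by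
  have hb : ∀ q ∈ (extChartAt 𝓘(ℝ, E) p).target ×ˢ (univ : Set E),
      (extChartAt 𝓘(ℝ, E) p).symm q.1 ∈ (trivializationAt E (TangentSpace 𝓘(ℝ, E)) p).baseSet := by
    intro q hq
    simpa using chart_symm_mem_source hq.1
  refine ((trivializationAt E (TangentSpace 𝓘(ℝ, E)) p).contMDiffOn_iff ?_).2 ⟨?_, ?_⟩
  · intro q hq
    rw [Trivialization.mem_source]
    exact hb q hq
  · exact (contMDiffOn_extChartAt_symm p).comp contDiff_fst.contMDiff.contMDiffOn fun q hq => hq.1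
  · refine ContMDiffOn.congr (f := fun q : E × E => q.2) contDiff_snd.contMDiff.contMDiffOn
      fun q hq => ?_
    rw [vecAt_eq_symmL hq.1]
    have h1 := (trivializationAt E (TangentSpace 𝓘(ℝ, E)) p).apply_mk_symm (hb q hq) q.2
    rw [← Trivialization.symmL_apply (R := ℝ) _ (hb q hq)] at h1
    exact congrArg Prod.snd h1

/-- The retraction in the chart around `p`. -/
def chartRetraction (R : Retraction E M) (p : M) (q : E × E) : E :=
  extChartAt 𝓘(ℝ, E) p (R ((extChartAt 𝓘(ℝ, E) p).symm q.1) (vecAt p q.1 q.2))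

lemma contMDiffAt_retraction_vecAt (R : Retraction E M) {q : E × E}
    (hq : q.1 ∈ (extChartAt 𝓘(ℝ, E) p).target) :
    ContMDiffAt 𝓘(ℝ, E × E) 𝓘(ℝ, E) ∞
      (fun q : E × E => R ((extChartAt 𝓘(ℝ, E) p).symm q.1) (vecAt p q.1 q.2)) q := by
  have h1 := (contMDiffOn_vecAt p).contMDiffAt
    (((isOpen_target p).prod isOpen_univ).mem_nhds (⟨hq, mem_univ _⟩ : q ∈ _ ×ˢ univ))
  exact R.smooth.contMDiffAt.comp q h1

lemma contDiffAt_chartRetraction (R : Retraction E M) {q : E × E}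
    (hq : q.1 ∈ (extChartAt 𝓘(ℝ, E) p).target)
    (hR : R ((extChartAt 𝓘(ℝ, E) p).symm q.1) (vecAt p q.1 q.2) ∈ (chartAt E p).source) :
    ContDiffAt ℝ ∞ (chartRetraction R p) q := by
  rw [← contMDiffAt_iff_contDiffAt]
  exact (contMDiffAt_extChartAt' hR).comp q (contMDiffAt_retraction_vecAt R hq)

lemma chartRetraction_zero (R : Retraction E M) (hz : z ∈ (extChartAt 𝓘(ℝ, E) p).target) :
    chartRetraction R p (z, 0) = z := by
  simp only [chartRetraction, map_zero, R.map_zero]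
  exact (extChartAt 𝓘(ℝ, E) p).right_inv hz

section
variable [IsContMDiffRiemannianBundle 𝓘(ℝ, E) ∞ E (fun x : M => TangentSpace 𝓘(ℝ, E) x)]

variable (E M) in
lemma isContinuousRiemannianBundle :
    IsContinuousRiemannianBundle E (fun x : M => TangentSpace 𝓘(ℝ, E) x) := by
  obtain ⟨g, hg, h⟩ := IsContMDiffRiemannianBundle.exists_contMDiff (IB := 𝓘(ℝ, E)) (n := ∞)
    (F := E) (E := fun x : M => TangentSpace 𝓘(ℝ, E) x)
  exact ⟨g, hg.continuous, h⟩

lemma contDiffOn_chartMetric (p : M) (u w : E) :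
    ContDiffOn ℝ ∞ (fun z => chartMetric p z u w) (extChartAt 𝓘(ℝ, E) p).target := by
  rw [← contMDiffOn_iff_contDiffOn]
  have h : ∀ u : E, ContMDiffOn 𝓘(ℝ, E) 𝓘(ℝ, E).tangent ∞
      (fun z : E => (⟨(extChartAt 𝓘(ℝ, E) p).symm z, vecAt p z u⟩ :
        TangentBundle 𝓘(ℝ, E) M)) (extChartAt 𝓘(ℝ, E) p).target := fun u =>
    (contMDiffOn_vecAt p).comp (f := fun z : E => (z, u))
      (contDiff_prodMk_left u).contMDiff.contMDiffOn fun z hz => ⟨hz, mem_univ _⟩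
  exact ContMDiffOn.inner_bundle (E := fun x : M => TangentSpace 𝓘(ℝ, E) x)
    (b := (extChartAt 𝓘(ℝ, E) p).symm) (v := fun z => vecAt p z u) (w := fun z => vecAt p z w)
    (h u) (h w)

lemma chartMetric_eq (p : M) (z u w : E) :
    chartMetric p z u w = inner ℝ (vecAt p z u) (vecAt p z w) := rfl

/-- Continuity of the Riemannian metric bounds the trivialization and its inverse near `p`; this
makes Riemannian norms and coordinate norms equivalent with a uniform constant. -/
lemma exists_norm_vecAt_le (p : M) : ∃ C > 0, ∀ᶠ z in 𝓝 (extChartAt 𝓘(ℝ, E) p p),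
    (∀ u, ‖vecAt p z u‖ ≤ C * ‖u‖) ∧
    ∀ v : TangentSpace 𝓘(ℝ, E) ((extChartAt 𝓘(ℝ, E) p).symm z),
      ‖chartVecL p ((extChartAt 𝓘(ℝ, E) p).symm z) v‖ ≤ C * ‖v‖ := by
  have := isContinuousRiemannianBundle E M
  obtain ⟨C₁, hC₁, h₁⟩ := eventually_norm_symmL_trivializationAt_lt E
    (fun x : M => TangentSpace 𝓘(ℝ, E) x) p
  obtain ⟨C₂, hC₂, h₂⟩ := eventually_norm_trivializationAt_lt E
    (fun x : M => TangentSpace 𝓘(ℝ, E) x) p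
  refine ⟨max C₁ C₂, lt_max_of_lt_left hC₁, ?_⟩
  have hc : Tendsto (extChartAt 𝓘(ℝ, E) p).symm (𝓝 (extChartAt 𝓘(ℝ, E) p p)) (𝓝 p) := by
    have := continuousAt_extChartAt_symm (I := 𝓘(ℝ, E)) p
    simpa [ContinuousAt] using this
  filter_upwards [hc.eventually h₁, hc.eventually h₂,
    extChartAt_target_mem_nhds (I := 𝓘(ℝ, E)) p] with z h₁ h₂ hz
  refine ⟨fun u => ?_, fun v => ?_⟩
  · rw [vecAt_eq_symmL hz]
    refine (ContinuousLinearMap.le_opNorm _ _).trans ?_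
    gcongr
    exact h₁.le.trans (le_max_left _ _)
  · have h := TangentBundle.continuousLinearMapAt_trivializationAt (𝕜 := ℝ) (I := 𝓘(ℝ, E))
      (chart_symm_mem_source hz)
    have h3 : chartVecL p ((extChartAt 𝓘(ℝ, E) p).symm z) v =
      (trivializationAt E (TangentSpace 𝓘(ℝ, E)) p).continuousLinearMapAt ℝ
        ((extChartAt 𝓘(ℝ, E) p).symm z) v := DFunLike.congr_fun h.symm v
    rw [h3]
    refine (ContinuousLinearMap.le_opNorm _ _).trans ?_
    gcongr
    exact h₂.le.trans (le_max_right _ _)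
end

lemma hasFDerivAt_comp_chart_symm {f : M → ℝ} (hf : MDifferentiable 𝓘(ℝ, E) 𝓘(ℝ, ℝ) f)
    (hz : z ∈ (extChartAt 𝓘(ℝ, E) p).target) :
    HasFDerivAt (fun z => f ((extChartAt 𝓘(ℝ, E) p).symm z))
      ((mvfderiv 𝓘(ℝ, E) f ((extChartAt 𝓘(ℝ, E) p).symm z)).comp (vecAt p z)) z := by
  have h1 : MDifferentiableAt 𝓘(ℝ, E) 𝓘(ℝ, E) (extChartAt 𝓘(ℝ, E) p).symm z :=
    ((contMDiffOn_extChartAt_symm (n := ∞) p).contMDiffAt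
      ((isOpen_target p).mem_nhds hz)).mdifferentiableAt (by simp)
  exact ((hf _).hasMFDerivAt.comp z h1.hasMFDerivAt).hasFDerivAt

lemma velocity_chart_symm {c : ℝ → E} {t : ℝ} {u : E} (hc : HasDerivAt c u t)
    (ht : t ∈ Icc (0 : ℝ) 1) (hz : c t ∈ (extChartAt 𝓘(ℝ, E) p).target) :
    velocity (E := E) (fun t => (extChartAt 𝓘(ℝ, E) p).symm (c t)) t = vecAt p (c t) u := by
  have h1 : MDifferentiableAt 𝓘(ℝ, E) 𝓘(ℝ, E) (extChartAt 𝓘(ℝ, E) p).symm (c t) :=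
    ((contMDiffOn_extChartAt_symm (n := ∞) p).contMDiffAt
      ((isOpen_target p).mem_nhds hz)).mdifferentiableAt (by simp)
  have h2 : HasMFDerivAt 𝓘(ℝ, ℝ) 𝓘(ℝ, E) c t (ContinuousLinearMap.toSpanSingleton ℝ u) :=
    hc.hasFDerivAt.hasMFDerivAt
  have h3 := (h1.hasMFDerivAt.comp t h2).hasMFDerivWithinAt (s := Icc 0 1)
  have h4 := h3.mfderivWithin
    ((uniqueDiffOn_Icc zero_lt_one t ht).uniqueMDiffWithinAt)
  have h5 := DFunLike.congr_fun h4 (1 : ℝ)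
  refine h5.trans ?_
  show vecAt p (c t) ((ContinuousLinearMap.toSpanSingleton ℝ u) (1 : ℝ)) = _
  simp

end Coordinates

/-! ### Lipschitz cut-offs, distances and Christoffel symbols in a chart -/

set_option synthInstance.maxHeartbeats 200000

noncomputable section Coordinates

variable {E : Type*} [NormedAddCommGroup E] [NormedSpace ℝ E] [FiniteDimensional ℝ E]
  {M : Type*} [EMetricSpace M] [ChartedSpace E M] [IsManifold 𝓘(ℝ, E) ∞ M]
  [RiemannianBundle (fun x : M => TangentSpace 𝓘(ℝ, E) x)]
  [IsContMDiffRiemannianBundle 𝓘(ℝ, E) ∞ E (fun x : M => TangentSpace 𝓘(ℝ, E) x)]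

/-- A map which is `C¹` near `x` agrees near `x` with a bounded, globally Lipschitz map. -/
lemma exists_lipschitz_bounded_eventuallyEq {F : Type*} [NormedAddCommGroup F] [NormedSpace ℝ F]
    {f : E → F} {s : Set E} {x : E} (hs : s ∈ 𝓝 x) (hf : ContDiffOn ℝ 1 f s) :
    ∃ (g : E → F) (K : ℝ≥0) (C : ℝ), LipschitzWith K g ∧ (∀ z, ‖g z‖ ≤ C) ∧ g =ᶠ[𝓝 x] f := by
  obtain ⟨r, hr, hball⟩ := Metric.mem_nhds_iff.1 hs
  let χ : ContDiffBump x := ⟨r / 4, r / 2, by positivity, by linarith⟩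
  have hg : ContDiff ℝ 1 fun z => χ z • f z := by
    rw [contDiff_iff_contDiffAt]
    intro z
    by_cases hz : z ∈ Metric.closedBall x (r / 2)
    · have hz' := Metric.closedBall_subset_ball (by linarith : r / 2 < r) hz
      exact χ.contDiffAt.smul
        (hf.contDiffAt (mem_of_superset (Metric.isOpen_ball.mem_nhds hz') hball))
    · refine (contDiffAt_const (c := 0)).congr_of_eventuallyEq ?_
      filter_upwards [Metric.isClosed_closedBall.isOpen_compl.mem_nhds hz] with y hy
      have h1 : ¬ dist y x ≤ r / 2 := hy
      rw [χ.zero_of_le_dist (not_le.1 h1).le, zero_smul]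
  have hcs : HasCompactSupport fun z => χ z • f z := χ.hasCompactSupport.smul_right
  obtain ⟨K, hK⟩ := ContDiff.lipschitzWith_of_hasCompactSupport hcs hg (by simp)
  obtain ⟨C, hC⟩ := hcs.exists_bound_of_continuous hg.continuous
  refine ⟨_, K, C, hK, hC, ?_⟩
  filter_upwards [χ.eventuallyEq_one] with z h1
  rw [h1]
  exact one_smul ℝ (f z)

/-- The Riemannian distance is at most the length of the image of the coordinate segment, whose
speed is bounded by `exists_norm_vecAt_le`. -/
lemma exists_edist_chart_symm_le [IsRiemannianManifold 𝓘(ℝ, E) M] (p : M) :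
    ∃ C > 0, ∃ δ > 0, ∀ z₁ ∈ Metric.ball (extChartAt 𝓘(ℝ, E) p p) δ,
      ∀ z₂ ∈ Metric.ball (extChartAt 𝓘(ℝ, E) p p) δ,
      edist ((extChartAt 𝓘(ℝ, E) p).symm z₁) ((extChartAt 𝓘(ℝ, E) p).symm z₂)
        ≤ ENNReal.ofReal (C * ‖z₂ - z₁‖) := by
  obtain ⟨C, hC, h⟩ := exists_norm_vecAt_le (E := E) p
  obtain ⟨δ, hδ, hball⟩ := Metric.eventually_nhds_iff_ball.1
    (h.and (extChartAt_target_mem_nhds (I := 𝓘(ℝ, E)) p))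
  refine ⟨C, hC, δ, hδ, fun z₁ h₁ z₂ h₂ => ?_⟩
  let c : ℝ → E := fun t => z₁ + t • (z₂ - z₁)
  have hc : ∀ t ∈ Icc (0 : ℝ) 1, c t ∈ Metric.ball (extChartAt 𝓘(ℝ, E) p p) δ := fun t ht =>
    (convex_ball _ _).add_smul_sub_mem h₁ h₂ ht
  have hcd : ∀ t, HasDerivAt c (z₂ - z₁) t := fun t => by
    have h1 := ((hasDerivAt_id t).smul_const (z₂ - z₁)).const_add z₁
    rwa [one_smul] at h1
  rw [IsRiemannianManifold.out (I := 𝓘(ℝ, E))]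
  refine (Manifold.riemannianEDist_le_pathELength
    (γ := fun t => (extChartAt 𝓘(ℝ, E) p).symm (c t)) (a := 0) (b := 1) ?_ (by simp [c])
    (by simp [c]) zero_le_one).trans ?_
  · refine (contMDiffOn_extChartAt_symm p).comp (ContDiff.contMDiff ?_).contMDiffOn
      fun t ht => (hball _ (hc t ht)).2
    fun_prop
  · rw [Manifold.pathELength_eq_lintegral_mfderivWithin_Icc]
    refine (MeasureTheory.setLIntegral_mono' (g := fun _ => ENNReal.ofReal (C * ‖z₂ - z₁‖))
      measurableSet_Icc fun t ht => ?_).trans ?_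
    · have h1 := velocity_chart_symm (p := p) (hcd t) ht (hball _ (hc t ht)).2
      have h2 := (hball _ (hc t ht)).1.1 (z₂ - z₁)
      rw [← h1] at h2
      rw [← ofReal_norm]
      exact ENNReal.ofReal_le_ofReal h2
    · simp

/-- The metric tensor in the chart around `p`, as a continuous bilinear form. -/
def metricForm (p : M) (z : E) : E →L[ℝ] E →L[ℝ] ℝ :=
  (innerSL ℝ).bilinearComp (vecAt p z) (vecAt p z)

lemma metricForm_apply (p : M) (z u w : E) : metricForm p z u w = chartMetric p z u w := rfl

lemma contDiffOn_metricForm (p : M) :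
    ContDiffOn ℝ ∞ (metricForm p) (extChartAt 𝓘(ℝ, E) p).target := by
  rw [contDiffOn_clm_apply]
  intro u
  rw [contDiffOn_clm_apply]
  exact fun w => contDiffOn_chartMetric p u w

/-- Positive definiteness gives injectivity, and a finite-dimensional space has the dimension of its
dual. -/
lemma isInvertible_metricForm {p : M} {z : E} (hz : z ∈ (extChartAt 𝓘(ℝ, E) p).target) :
    (metricForm p z).IsInvertible := by
  have hinj : Function.Injective (metricForm p z).toLinearMap := by
    rw [← LinearMap.ker_eq_bot, LinearMap.ker_eq_bot']
    intro u hu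
    have h1 : metricForm p z u u = 0 := by
      have : metricForm p z u = 0 := hu
      rw [this]; rfl
    have h2 : vecAt p z u = 0 := inner_self_eq_zero (𝕜 := ℝ).1 h1
    rw [← chartVecL_vecAt hz u, h2, map_zero]
  have hfin : Module.finrank ℝ E = Module.finrank ℝ (E →L[ℝ] ℝ) := by
    rw [← Subspace.dual_finrank_eq]
    exact (LinearMap.toContinuousLinearMap (𝕜 := ℝ) (E := E) (F' := ℝ)).finrank_eq
  refine ⟨(LinearEquiv.ofInjectiveOfFinrankEq (metricForm p z).toLinearMap hinj hfin).toContinuousLinearEquiv, ?_⟩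
  ext u w
  rfl

lemma differentiableAt_chartMetric {p : M} {z : E} (hz : z ∈ (extChartAt 𝓘(ℝ, E) p).target)
    (u w : E) : DifferentiableAt ℝ (fun z => chartMetric p z u w) z :=
  ((contDiffOn_chartMetric p u w).contDiffAt ((isOpen_target p).mem_nhds hz)).differentiableAt
    (by simp)

lemma fderiv_chartMetric_linear {p : M} {z : E} (hz : z ∈ (extChartAt 𝓘(ℝ, E) p).target)
    (s : ℝ) (a u u' w : E) :
    fderiv ℝ (fun z => chartMetric p z (s • u + u') w) z a
      = s * fderiv ℝ (fun z => chartMetric p z u w) z a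
        + fderiv ℝ (fun z => chartMetric p z u' w) z a := by
  have h : (fun z => chartMetric p z (s • u + u') w)
      = fun z => s * chartMetric p z u w + chartMetric p z u' w := by
    funext z
    simp [← metricForm_apply]
  rw [h, fderiv_fun_add ((differentiableAt_chartMetric hz u w).const_mul s)
    (differentiableAt_chartMetric hz u' w), fderiv_const_mul (differentiableAt_chartMetric hz u w)]
  simp

lemma chartMetric_comm (p : M) (z u w : E) : chartMetric p z u w = chartMetric p z w u := by
  rw [chartMetric_eq, chartMetric_eq, real_inner_comm]

lemma fderiv_chartMetric_comm (p : M) (z a u w : E) :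
    fderiv ℝ (fun z => chartMetric p z u w) z a = fderiv ℝ (fun z => chartMetric p z w u) z a := by
  simp only [chartMetric_comm p _ u w]

section Christoffel

variable {p : M} {z : E}

lemma christoffel_linear_left (hz : z ∈ (extChartAt 𝓘(ℝ, E) p).target)
    (s : ℝ) (a a' b w : E) :
    christoffel p z (s • a + a') b w = s * christoffel p z a b w + christoffel p z a' b w := by
  simp only [christoffel, fderiv_chartMetric_linear hz, map_add, map_smul, smul_eq_mul]
  ring

lemma christoffel_comm (a b w : E) : christoffel p z a b w = christoffel p z b a w := by
  simp only [christoffel, fderiv_chartMetric_comm p z w a b]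
  ring

lemma christoffel_linear_right (hz : z ∈ (extChartAt 𝓘(ℝ, E) p).target)
    (s : ℝ) (a b w w' : E) :
    christoffel p z a b (s • w + w') = s * christoffel p z a b w + christoffel p z a b w' := by
  simp only [christoffel, fderiv_chartMetric_comm p z _ _ (s • w + w'),
    fderiv_chartMetric_linear hz, map_add, map_smul, smul_eq_mul,
    fderiv_chartMetric_comm p z _ w, fderiv_chartMetric_comm p z _ w']
  ring

/-- The Christoffel symbols of the first kind as a linear form in the last argument. -/
lemma exists_christoffel_dual (hz : z ∈ (extChartAt 𝓘(ℝ, E) p).target)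
    (a b : E) :
    ∃ κ : E →L[ℝ] ℝ, ∀ w, κ w = christoffel p z a b w :=
  ⟨LinearMap.toContinuousLinearMap
    { toFun := fun w => christoffel p z a b w
      map_add' := fun w w' => by simpa using christoffel_linear_right hz 1 a b w w'
      map_smul' := fun s w => by
        have h0 := christoffel_linear_right hz 1 a b 0 0
        have h1 := christoffel_linear_right hz s a b w 0
        simp only [smul_zero, add_zero, one_mul] at h0 h1
        simpa [h1] using h0 }, fun _ => rfl⟩

lemma exists_christoffel_vec (hz : z ∈ (extChartAt 𝓘(ℝ, E) p).target)
    (a b : E) :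
    ∃ v : E, ∀ w, chartMetric p z v w = christoffel p z a b w := by
  obtain ⟨e, he⟩ := isInvertible_metricForm hz
  obtain ⟨κ, hκ⟩ := exists_christoffel_dual hz a b
  refine ⟨e.symm κ, fun w => ?_⟩
  rw [← metricForm_apply, ← he, ← hκ]
  simp

lemma eq_of_forall_chartMetric_eq (hz : z ∈ (extChartAt 𝓘(ℝ, E) p).target)
    {v v' : E} (h : ∀ w, chartMetric p z v w = chartMetric p z v' w) :
    v = v' := by
  obtain ⟨e, he⟩ := isInvertible_metricForm hz
  apply e.injective
  ext w
  have := h w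
  rwa [← metricForm_apply, ← metricForm_apply, ← he] at this

/-- The Christoffel symbols of the second kind. -/
lemma exists_christoffel_snd (hz : z ∈ (extChartAt 𝓘(ℝ, E) p).target)
    :
    ∃ G : E →L[ℝ] E →L[ℝ] E, ∀ a b w, chartMetric p z (G a b) w = christoffel p z a b w := by
  choose v hv using exists_christoffel_vec hz
  -- `v` is only chosen pointwise; nondegeneracy of the metric makes it unique, so linearity and
  -- symmetry pass to it from the symbols of the first kind.
  have lin : ∀ (s : ℝ) a a' b, v (s • a + a') b = s • v a b + v a' b := by
    intro s a a' b
    refine eq_of_forall_chartMetric_eq hz fun w => ?_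
    rw [hv, christoffel_linear_left hz, ← hv, ← hv]
    simp [← metricForm_apply]
  have comm : ∀ a b, v a b = v b a := fun a b =>
    eq_of_forall_chartMetric_eq hz fun w => by rw [hv, hv, christoffel_comm]
  have zero : ∀ b, v 0 b = 0 := fun b => by
    have := lin 1 0 0 b
    simpa using this
  have add : ∀ a a' b, v (a + a') b = v a b + v a' b := fun a a' b => by
    simpa using lin 1 a a' b
  have smul : ∀ (s : ℝ) a b, v (s • a) b = s • v a b := fun s a b => by
    simpa [zero] using lin s a 0 b
  let G : E →ₗ[ℝ] E →ₗ[ℝ] E := LinearMap.mk₂ ℝ v add smul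
    (fun a b b' => by rw [comm, add, comm b, comm b'])
    (fun s a b => by rw [comm, smul, comm b])
  exact ⟨LinearMap.toContinuousLinearMap
    ((LinearMap.toContinuousLinearMap : (E →ₗ[ℝ] E) ≃ₗ[ℝ] (E →L[ℝ] E)).toLinearMap ∘ₗ G), hv⟩

end Christoffel

lemma contDiffOn_christoffel (p : M) (a b w : E) :
    ContDiffOn ℝ 1 (fun z => christoffel p z a b w) (extChartAt 𝓘(ℝ, E) p).target := by
  have h : ∀ a b w : E, ContDiffOn ℝ 1 (fun z => fderiv ℝ (fun z' => chartMetric p z' b w) z a)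
      (extChartAt 𝓘(ℝ, E) p).target := fun a b w =>
    ((contDiffOn_chartMetric p b w).fderiv_of_isOpen (m := 1) (isOpen_target p)
      (by norm_num; exact WithTop.coe_le_coe.2 le_top)).clm_apply contDiffOn_const
  exact (((h a b w).add (h b a w)).sub (h w a b)).div_const 2

/-- `Γ z a b` is the inverse of the metric form applied to the first-kind symbols, and inversion of
continuous linear maps is smooth at invertible ones. -/
lemma contDiffOn_of_chartMetric_eq_christoffel {p : M} {Γ : E → E →L[ℝ] E →L[ℝ] E}
    (hΓ : ∀ z ∈ (extChartAt 𝓘(ℝ, E) p).target, ∀ a b w,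
      chartMetric p z (Γ z a b) w = christoffel p z a b w) :
    ContDiffOn ℝ 1 Γ (extChartAt 𝓘(ℝ, E) p).target := by
  rw [contDiffOn_clm_apply]
  intro a
  rw [contDiffOn_clm_apply]
  intro b z hz
  have hn := (isOpen_target p).mem_nhds hz
  have h1 : ContDiffAt ℝ 1 (fun z => (metricForm p z).inverse) z := by
    obtain ⟨e, he⟩ := isInvertible_metricForm hz
    have h2 := contDiffAt_map_inverse (𝕜 := ℝ) (n := 1) e
    rw [he] at h2
    exact h2.comp z (((contDiffOn_metricForm p).contDiffAt hn).of_le (by simp))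
  have h2 : ContDiffOn ℝ 1 (fun z => metricForm p z (Γ z a b)) (extChartAt 𝓘(ℝ, E) p).target := by
    rw [contDiffOn_clm_apply]
    exact fun w => (contDiffOn_christoffel p a b w).congr fun z hz => hΓ z hz a b w
  refine ((h1.clm_apply (h2.contDiffAt hn)).congr_of_eventuallyEq ?_).contDiffWithinAt
  filter_upwards [hn] with y hy
  obtain ⟨e, he⟩ := isInvertible_metricForm hy
  rw [← he, ContinuousLinearMap.inverse_equiv]
  simp

/-- The Christoffel symbols near `p` extend to a bounded, globally Lipschitz field. -/
lemma exists_lipschitz_christoffel (p : M) :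
    ∃ (Γ : E → E →L[ℝ] E →L[ℝ] E) (K : ℝ≥0) (C : ℝ), LipschitzWith K Γ ∧ (∀ z, ‖Γ z‖ ≤ C) ∧
      ∀ᶠ z in 𝓝 (extChartAt 𝓘(ℝ, E) p p), ∀ a b w,
        chartMetric p z (Γ z a b) w = christoffel p z a b w := by
  have hex : ∀ z, ∃ G : E →L[ℝ] E →L[ℝ] E, z ∈ (extChartAt 𝓘(ℝ, E) p).target →
      ∀ a b w, chartMetric p z (G a b) w = christoffel p z a b w := fun z => by
    by_cases hz : z ∈ (extChartAt 𝓘(ℝ, E) p).target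
    · obtain ⟨G, hG⟩ := exists_christoffel_snd hz
      exact ⟨G, fun _ => hG⟩
    · exact ⟨0, fun h => absurd h hz⟩
  choose Γ₀ hΓ₀ using hex
  have hn := extChartAt_target_mem_nhds (I := 𝓘(ℝ, E)) p
  obtain ⟨Γ, K, C, hK, hC, heq⟩ := exists_lipschitz_bounded_eventuallyEq hn
    (contDiffOn_of_chartMetric_eq_christoffel hΓ₀)
  refine ⟨Γ, K, C, hK, hC, ?_⟩
  filter_upwards [heq, hn] with z h1 hz
  rw [h1]
  exact hΓ₀ z hz

/-! ### Geodesics and parallel fields in a chart, and the coordinates of Lipschitz fields -/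

lemma isParallel_chart_symm {p : M} {c u v : ℝ → E} {Γ : E → E →L[ℝ] E →L[ℝ] E}
    (hc : ∀ t ∈ Icc (0 : ℝ) 1, HasDerivAt c (u t) t)
    (hT : ∀ t ∈ Icc (0 : ℝ) 1, c t ∈ (extChartAt 𝓘(ℝ, E) p).target)
    (hΓ : ∀ t ∈ Icc (0 : ℝ) 1, ∀ a b w,
      chartMetric p (c t) (Γ (c t) a b) w = christoffel p (c t) a b w)
    (hv : ∀ t ∈ Icc (0 : ℝ) 1, HasDerivWithinAt v (-(Γ (c t) (u t) (v t))) (Icc 0 1) t)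
    {W : ∀ t, TangentSpace 𝓘(ℝ, E) ((extChartAt 𝓘(ℝ, E) p).symm (c t))}
    (hW : ∀ t ∈ Icc (0 : ℝ) 1, W t = vecAt p (c t) (v t)) :
    IsParallel (fun t => (extChartAt 𝓘(ℝ, E) p).symm (c t)) W := by
  have hcv : ∀ t ∈ Icc (0 : ℝ) 1, chartVec p ((extChartAt 𝓘(ℝ, E) p).symm (c t)) (W t) = v t := by
    intro t ht
    rw [hW t ht, ← chartVecL_apply]
    exact chartVecL_vecAt (hT t ht) (v t)
  intro t ht
  refine ⟨p, chart_symm_mem_source (hT t ht), -(Γ (c t) (u t) (v t)),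
    (hv t ht).congr hcv (hcv t ht), fun w => ?_⟩
  have h1 : chartVec p ((extChartAt 𝓘(ℝ, E) p).symm (c t))
      (velocity (E := E) (fun t => (extChartAt 𝓘(ℝ, E) p).symm (c t)) t) = u t := by
    rw [velocity_chart_symm (hc t ht) ht (hT t ht), ← chartVecL_apply]
    exact chartVecL_vecAt (hT t ht) (u t)
  simp only [h1, hcv t ht, (extChartAt 𝓘(ℝ, E) p).right_inv (hT t ht)]
  rw [← hΓ t ht, ← metricForm_apply, ← metricForm_apply, map_neg]
  simp

lemma isGeodesic_chart_symm {p : M} {c u : ℝ → E} {Γ : E → E →L[ℝ] E →L[ℝ] E}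
    (hc : ∀ t, HasDerivAt c (u t) t) (hu : Continuous u)
    (hT : ∀ t ∈ Icc (0 : ℝ) 1, c t ∈ (extChartAt 𝓘(ℝ, E) p).target)
    (hΓ : ∀ t ∈ Icc (0 : ℝ) 1, ∀ a b w,
      chartMetric p (c t) (Γ (c t) a b) w = christoffel p (c t) a b w)
    (hv : ∀ t ∈ Icc (0 : ℝ) 1, HasDerivWithinAt u (-(Γ (c t) (u t) (u t))) (Icc 0 1) t) :
    IsGeodesic E (fun t => (extChartAt 𝓘(ℝ, E) p).symm (c t)) := by
  refine ⟨?_, isParallel_chart_symm (fun t _ => hc t) hT hΓ hv fun t ht =>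
    velocity_chart_symm (hc t) ht (hT t ht)⟩
  have h1 : ContDiff ℝ 1 c := by
    rw [contDiff_one_iff_deriv]
    refine ⟨fun t => (hc t).differentiableAt, ?_⟩
    rwa [funext fun t => (hc t).deriv]
  exact (contMDiffOn_extChartAt_symm p).comp h1.contMDiff.contMDiffOn hT

/-- Parallel transport of a locally Lipschitz vector field between close points, in a chart. -/
lemma exists_transport_estimate [IsRiemannianManifold 𝓘(ℝ, E) M]
    {ξ : ∀ x : M, TangentSpace 𝓘(ℝ, E) x}
    (hξ : IsLocallyLipschitzField ξ) (p : M) :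
    ∃ δ > 0, ∃ C > 0, C * (2 * δ) ≤ 1 / 2 ∧
      ∀ z₁ ∈ Metric.ball (extChartAt 𝓘(ℝ, E) p p) δ, ∀ z₂ ∈ Metric.ball (extChartAt 𝓘(ℝ, E) p p) δ,
      ∃ v : E,
        ‖v - chartVecL p ((extChartAt 𝓘(ℝ, E) p).symm z₁) (ξ ((extChartAt 𝓘(ℝ, E) p).symm z₁))‖
          ≤ C * ‖z₂ - z₁‖ ∧
        ‖v - chartVecL p ((extChartAt 𝓘(ℝ, E) p).symm z₂) (ξ ((extChartAt 𝓘(ℝ, E) p).symm z₂))‖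
          ≤ C * ‖z₂ - z₁‖ *
            ‖chartVecL p ((extChartAt 𝓘(ℝ, E) p).symm z₂) (ξ ((extChartAt 𝓘(ℝ, E) p).symm z₂))‖ := by
  set z₀ := extChartAt 𝓘(ℝ, E) p p with hz₀
  set X : E → E := fun z => chartVecL p ((extChartAt 𝓘(ℝ, E) p).symm z)
    (ξ ((extChartAt 𝓘(ℝ, E) p).symm z)) with hX
  obtain ⟨Γ, K, C₀, hK, hC₀, hΓ⟩ := exists_lipschitz_christoffel (E := E) p
  obtain ⟨Cn, hCn, hn⟩ := exists_norm_vecAt_le (E := E) p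
  obtain ⟨Ce, hCe, δe, hδe, he⟩ := exists_edist_chart_symm_le (E := E) p
  have hC₀0 : 0 ≤ C₀ := (norm_nonneg (Γ 0)).trans (hC₀ 0)
  obtain ⟨r', hr', hball'⟩ := Metric.eventually_nhds_iff_ball.1
    ((hΓ.and hn).and (extChartAt_target_mem_nhds (I := 𝓘(ℝ, E)) p))
  set r := r' / 2 with hr
  have hrpos : 0 < r := by positivity
  have hball : ∀ z ∈ Metric.closedBall z₀ r, _ := fun z hz =>
    hball' z (Metric.closedBall_subset_ball (by linarith) hz)
  have hKc : IsCompact ((extChartAt 𝓘(ℝ, E) p).symm '' Metric.closedBall z₀ r) :=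
    (isCompact_closedBall z₀ r).image_of_continuousOn
      ((continuousOn_extChartAt_symm p).mono fun z hz => (hball z hz).2)
  obtain ⟨rr, hrr, Lv, hLv⟩ := hξ _ hKc
  set C := Cn * Lv * Ce + 4 * C₀ + 1 with hC
  have hCpos : 0 < C := by positivity
  have hC4 : 4 * C₀ ≤ C := by rw [hC]; nlinarith [mul_nonneg (mul_nonneg hCn.le Lv.coe_nonneg) hCe.le]
  have hCL : Cn * Lv * Ce ≤ C := by rw [hC]; linarith
  -- In this order the conditions serve to compare distances, to keep the geodesic in the ball of
  -- radius `r`, to solve the boundary value problem, to make the geodesic shorter than `rr`, and to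
  -- make transport a small perturbation.
  obtain ⟨δ, hδ, h1, h2, h3, h4, h5⟩ : ∃ δ > 0, δ ≤ δe ∧ 5 * δ ≤ r ∧
      2 * δ ≤ 1 / (16 * (K + C₀) + 1) ∧ Cn * (4 * δ) < rr ∧ C * (2 * δ) ≤ 1 / 2 := by
    have e : ∀ᶠ δ : ℝ in 𝓝[>] 0, 0 < δ := self_mem_nhdsWithin
    have t : ∀ a b : ℝ, 0 < b → ∀ᶠ δ : ℝ in 𝓝[>] 0, a * δ < b := fun a b hb => by
      have : Tendsto (fun δ : ℝ => a * δ) (𝓝[>] 0) (𝓝 (a * 0)) :=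
        (tendsto_id.mono_left nhdsWithin_le_nhds).const_mul a
      rw [mul_zero] at this
      exact this.eventually (gt_mem_nhds hb)
    obtain ⟨δ, h0, h1, h2, h3, h4, h5⟩ := (e.and ((t 1 δe hδe).and ((t 5 r hrpos).and
      ((t 2 (1 / (16 * (K + C₀) + 1)) (by positivity)).and
      ((t (Cn * 4) rr hrr).and (t (C * 2) (1 / 2) (by norm_num))))))).exists
    exact ⟨δ, h0, by linarith, h2.le, h3.le, by linarith, by linarith⟩
  refine ⟨δ, hδ, C, hCpos, h5, fun z₁ hz₁ z₂ hz₂ => ?_⟩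
  have ha : ‖z₂ - z₁‖ < 2 * δ := by
    rw [← dist_eq_norm]
    have := dist_triangle_right z₂ z₁ z₀
    rw [Metric.mem_ball] at hz₁ hz₂
    linarith
  obtain ⟨c, u, hc0, hc1, huc, hcd, hub, hgeo⟩ :=
    exists_geodesic_equation_solution hK hC₀ (ha.le.trans h3)
  have hcball : ∀ t ∈ Icc (0 : ℝ) 1, c t ∈ Metric.closedBall z₀ r := by
    intro t ht
    have h6 : ‖c t - c 0‖ ≤ 2 * ‖z₂ - z₁‖ * (t - 0) :=
      norm_image_sub_le_of_norm_deriv_le_segment' (fun s _ => (hcd s).hasDerivWithinAt)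
        (fun s _ => hub s) t ht
    rw [hc0, ← dist_eq_norm] at h6
    rw [Metric.mem_closedBall]
    rw [Metric.mem_ball] at hz₁
    have h7 := dist_triangle (c t) z₁ z₀
    nlinarith [ht.1, ht.2, norm_nonneg (z₂ - z₁)]
  have hA : Continuous fun t => Γ (c t) (u t) :=
    (hK.continuous.comp (continuous_iff_continuousAt.2 fun t => (hcd t).continuousAt)).clm_apply huc
  have hAb : ∀ t ∈ Icc (0 : ℝ) 1, ‖Γ (c t) (u t)‖ ≤ C₀ * (2 * ‖z₂ - z₁‖) := fun t _ =>
    (ContinuousLinearMap.le_opNorm _ _).trans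
      (mul_le_mul (hC₀ _) (hub t) (norm_nonneg _) hC₀0)
  obtain ⟨v, hv1, hvd, hvb⟩ := exists_linear_transport hA hAb
    (by nlinarith [norm_nonneg (z₂ - z₁)]) (X z₂)
  have hT : ∀ t ∈ Icc (0 : ℝ) 1, c t ∈ (extChartAt 𝓘(ℝ, E) p).target := fun t ht =>
    (hball _ (hcball t ht)).2
  have hΓc : ∀ t ∈ Icc (0 : ℝ) 1, ∀ a b w,
      chartMetric p (c t) (Γ (c t) a b) w = christoffel p (c t) a b w := fun t ht =>
    (hball _ (hcball t ht)).1.1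
  have h01 : (0 : ℝ) ∈ Icc (0 : ℝ) 1 := by simp
  have h11 : (1 : ℝ) ∈ Icc (0 : ℝ) 1 := by simp
  have hvel := velocity_chart_symm (p := p) (hcd 0) h01 (hT 0 h01)
  -- The Lipschitz hypothesis is tested on the constructed geodesic and on the parallel field that
  -- ends in `ξ`. The vector `v 0` is then close to the coordinates of `ξ` at `z₁` by hypothesis,
  -- and to those at `z₂` because transport moves coordinates little.
  have key := hLv (fun t => (extChartAt 𝓘(ℝ, E) p).symm (c t))
    (isGeodesic_chart_symm hcd huc hT hΓc hgeo) (mem_image_of_mem _ (hcball 0 h01))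
    (mem_image_of_mem _ (hcball 1 h11))
    (by
      rw [hvel]
      refine ((hball _ (hcball 0 h01)).1.2.1 (u 0)).trans_lt (lt_of_le_of_lt ?_ h4)
      have := hub 0
      gcongr
      linarith)
    (fun t => vecAt p (c t) (v t))
    (isParallel_chart_symm (fun t _ => hcd t) hT hΓc hvd fun t _ => rfl)
    (by
      have e1 : v 1 = X (c 1) := by rw [hv1, hc1]
      simp only [e1]
      exact vecAt_chartVecL (hT 1 h11) _)
  refine ⟨v 0, ?_, ?_⟩
  · have e1 : chartVecL p ((extChartAt 𝓘(ℝ, E) p).symm (c 0))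
        (vecAt p (c 0) (v 0) - ξ ((extChartAt 𝓘(ℝ, E) p).symm (c 0))) = v 0 - X (c 0) := by
      rw [map_sub, chartVecL_vecAt (hT 0 h01)]
    have e2 := (hball _ (hcball 0 h01)).1.2.2
      (vecAt p (c 0) (v 0) - ξ ((extChartAt 𝓘(ℝ, E) p).symm (c 0)))
    rw [e1, hc0] at e2
    have e3 : ‖vecAt p (c 0) (v 0) - ξ ((extChartAt 𝓘(ℝ, E) p).symm (c 0))‖
        ≤ Lv * (Ce * ‖z₂ - z₁‖) := by
      have e4 := he z₁ (Metric.ball_subset_ball h1 hz₁) z₂ (Metric.ball_subset_ball h1 hz₂)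
      have e5 := key.trans (mul_le_mul_right (by simpa only [hc0, hc1] using e4) _)
      rw [← ofReal_norm, ← ENNReal.ofReal_coe_nnreal, ← ENNReal.ofReal_mul Lv.coe_nonneg] at e5
      exact (ENNReal.ofReal_le_ofReal_iff (by positivity)).1 e5
    calc _ ≤ _ := e2
      _ ≤ Cn * (Lv * (Ce * ‖z₂ - z₁‖)) := by rw [← hc0] at e3 ⊢; gcongr
      _ = Cn * Lv * Ce * ‖z₂ - z₁‖ := by ring
      _ ≤ _ := by gcongr
  · refine (hvb 0 h01).trans ?_
    have : 2 * (C₀ * (2 * ‖z₂ - z₁‖)) = 4 * C₀ * ‖z₂ - z₁‖ := by ring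
    rw [this]
    gcongr

/-- The coordinates of a locally Lipschitz vector field are locally Lipschitz. -/
lemma exists_lipschitz_chartVecL [IsRiemannianManifold 𝓘(ℝ, E) M]
    {ξ : ∀ x : M, TangentSpace 𝓘(ℝ, E) x}
    (hξ : IsLocallyLipschitzField ξ) (p : M) :
    ∃ δ > 0, ∃ C > 0,
      ∀ z₁ ∈ Metric.ball (extChartAt 𝓘(ℝ, E) p p) δ, ∀ z₂ ∈ Metric.ball (extChartAt 𝓘(ℝ, E) p p) δ,
        ‖chartVecL p ((extChartAt 𝓘(ℝ, E) p).symm z₁) (ξ ((extChartAt 𝓘(ℝ, E) p).symm z₁))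
          - chartVecL p ((extChartAt 𝓘(ℝ, E) p).symm z₂) (ξ ((extChartAt 𝓘(ℝ, E) p).symm z₂))‖
          ≤ C * ‖z₂ - z₁‖ := by
  obtain ⟨δ, hδ, C, hC, hCδ, h⟩ := exists_transport_estimate hξ p
  set z₀ := extChartAt 𝓘(ℝ, E) p p with hz₀
  set X : E → E := fun z => chartVecL p ((extChartAt 𝓘(ℝ, E) p).symm z)
    (ξ ((extChartAt 𝓘(ℝ, E) p).symm z)) with hX
  -- The transport error is proportional to `‖X z₂‖`, and local boundedness of `X` is not known
  -- beforehand. Comparing `z` with the center, where `C * ‖z - z₀‖ ≤ 1 / 2`, allows `‖X z‖` to be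
  -- absorbed.
  have hb : ∀ z ∈ Metric.ball z₀ δ, ‖X z‖ ≤ 2 * (‖X z₀‖ + 1) := by
    intro z hz
    obtain ⟨v, h1, h2⟩ := h z₀ (Metric.mem_ball_self hδ) z hz
    change ‖v - X z₀‖ ≤ _ at h1
    change ‖v - X z‖ ≤ _ * ‖X z‖ at h2
    rw [Metric.mem_ball, dist_eq_norm] at hz
    have h3 : C * ‖z - z₀‖ ≤ 1 / 2 := by nlinarith
    have h4 := norm_le_norm_add_norm_sub v (X z)
    have h5 := norm_le_norm_add_norm_sub' v (X z₀)
    nlinarith [norm_nonneg (X z)]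
  refine ⟨δ, hδ, C + C * (2 * (‖X z₀‖ + 1)), by positivity, fun z₁ hz₁ z₂ hz₂ => ?_⟩
  obtain ⟨v, h1, h2⟩ := h z₁ hz₁ z₂ hz₂
  change ‖v - X z₁‖ ≤ _ at h1
  change ‖v - X z₂‖ ≤ _ * ‖X z₂‖ at h2
  change ‖X z₁ - X z₂‖ ≤ _
  have h3 := hb z₂ hz₂
  have h4 := norm_sub_le_norm_sub_add_norm_sub (X z₁) v (X z₂)
  rw [norm_sub_rev (X z₁) v] at h4
  have h5 : C * ‖z₂ - z₁‖ * ‖X z₂‖ ≤ C * ‖z₂ - z₁‖ * (2 * (‖X z₀‖ + 1)) := by gcongr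
  linarith

/-! ### The retraction in a chart -/

lemma chartRetraction_apply_chartVecL (R : Retraction E M) {p : M} {z : E}
    (hz : z ∈ (extChartAt 𝓘(ℝ, E) p).target)
    (η : TangentSpace 𝓘(ℝ, E) ((extChartAt 𝓘(ℝ, E) p).symm z)) :
    chartRetraction R p (z, chartVecL p _ η)
      = extChartAt 𝓘(ℝ, E) p (R ((extChartAt 𝓘(ℝ, E) p).symm z) η) := by
  simp only [chartRetraction, vecAt_chartVecL hz]

lemma continuousAt_retraction_fiber (R : Retraction E M) {p : M} {z : E}
    (hz : z ∈ (extChartAt 𝓘(ℝ, E) p).target)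
    (η : TangentSpace 𝓘(ℝ, E) ((extChartAt 𝓘(ℝ, E) p).symm z)) :
    ContinuousAt (fun η => R ((extChartAt 𝓘(ℝ, E) p).symm z) η) η := by
  have h1 : ContinuousAt (fun q : E × E => R ((extChartAt 𝓘(ℝ, E) p).symm q.1) (vecAt p q.1 q.2))
      (z, chartVecL p ((extChartAt 𝓘(ℝ, E) p).symm z) η) :=
    (contMDiffAt_retraction_vecAt R hz).continuousAt
  have h2 : ContinuousAt (fun η => (z, chartVecL p ((extChartAt 𝓘(ℝ, E) p).symm z) η)) η :=
    (continuous_const.prodMk (chartVecL p ((extChartAt 𝓘(ℝ, E) p).symm z)).continuous).continuousAt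
  have h3 := ContinuousAt.comp (f := fun η => (z, chartVecL p ((extChartAt 𝓘(ℝ, E) p).symm z) η))
    (x := η) h1 h2
  refine h3.congr (Eventually.of_forall fun η' => ?_)
  simp only [Function.comp_apply, vecAt_chartVecL hz]

lemma retraction_zero_mem_source (R : Retraction E M) {p : M} {z : E}
    (hz : z ∈ (extChartAt 𝓘(ℝ, E) p).target) :
    R ((extChartAt 𝓘(ℝ, E) p).symm z) (vecAt p z 0) ∈ (chartAt E p).source := by
  rw [map_zero, R.map_zero]
  exact chart_symm_mem_source hz

/-- The local rigidity of a retraction, in a chart. -/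
lemma fderiv_chartRetraction_zero (R : Retraction E M) {p : M} {z : E}
    (hz : z ∈ (extChartAt 𝓘(ℝ, E) p).target) (u : E) :
    fderiv ℝ (chartRetraction R p) (z, 0) (0, u) = u := by
  set x := (extChartAt 𝓘(ℝ, E) p).symm z with hx
  set η := vecAt p z u with hη
  have hρ : DifferentiableAt ℝ (chartRetraction R p) (z, 0) :=
    (contDiffAt_chartRetraction R hz (retraction_zero_mem_source R hz)).differentiableAt (by simp)
  have hl : HasDerivAt (fun t : ℝ => (z, t • u)) (0, u) 0 := by
    have := ((hasDerivAt_const (0 : ℝ) z).prodMk ((hasDerivAt_id (0 : ℝ)).smul_const u))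
    simpa using this
  have h1 : HasDerivAt (fun t : ℝ => chartRetraction R p (z, t • u))
      (fderiv ℝ (chartRetraction R p) (z, 0) (0, u)) 0 := by
    have h := hρ.hasFDerivAt
    have e : (z, (0 : E)) = (z, (0 : ℝ) • u) := by simp
    rw [e] at h ⊢
    exact h.comp_hasDerivAt (0 : ℝ) hl
  have hcurve : MDifferentiableAt 𝓘(ℝ, ℝ) 𝓘(ℝ, E) (fun t : ℝ => R x (t • η)) 0 := by
    have h2 : ContMDiffAt 𝓘(ℝ, E × E) 𝓘(ℝ, E) ∞
        (fun q : E × E => R ((extChartAt 𝓘(ℝ, E) p).symm q.1) (vecAt p q.1 q.2))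
        (z, (0 : ℝ) • u) := contMDiffAt_retraction_vecAt R hz
    have h3 : ContMDiffAt 𝓘(ℝ, ℝ) 𝓘(ℝ, E × E) ∞ (fun t : ℝ => (z, t • u)) 0 := by
      apply ContDiffAt.contMDiffAt
      fun_prop
    have h4 := (h2.comp (0 : ℝ) h3).mdifferentiableAt (by simp)
    refine h4.congr_of_eventuallyEq (Eventually.of_forall fun t => ?_)
    simp only [Function.comp_apply, map_smul]
    rfl
  have hmem : R x ((0 : ℝ) • η) ∈ (chartAt E p).source := by
    rw [zero_smul, R.map_zero]
    exact chart_symm_mem_source hz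
  have hφ : MDifferentiableAt 𝓘(ℝ, E) 𝓘(ℝ, E) (extChartAt 𝓘(ℝ, E) p) (R x ((0 : ℝ) • η)) :=
    mdifferentiableAt_extChartAt hmem
  have h5 := hφ.hasMFDerivAt.comp (0 : ℝ) hcurve.hasMFDerivAt
  have h6 : HasDerivAt (fun t : ℝ => chartRetraction R p (z, t • u))
      (chartVecL p (R x ((0 : ℝ) • η))
        (mfderiv 𝓘(ℝ, ℝ) 𝓘(ℝ, E) (fun t : ℝ => R x (t • η)) 0 (1 : ℝ))) 0 := by
    have e : (fun t : ℝ => chartRetraction R p (z, t • u))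
        = (extChartAt 𝓘(ℝ, E) p) ∘ fun t : ℝ => R x (t • η) := by
      funext t
      simp only [Function.comp_apply, chartRetraction, map_smul]
      rfl
    rw [e]
    have h7 : HasFDerivAt ((extChartAt 𝓘(ℝ, E) p) ∘ fun t : ℝ => R x (t • η))
        (((chartVecL p (R x ((0 : ℝ) • η))).comp
          (mfderiv 𝓘(ℝ, ℝ) 𝓘(ℝ, E) (fun t : ℝ => R x (t • η)) 0) : ℝ →L[ℝ] E)) (0 : ℝ) :=
      h5.hasFDerivAt
    exact h7.hasDerivAt
  rw [h1.unique h6]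
  -- The base point `R x (0 • η)` equals `x` only propositionally, so the velocity lies in a
  -- formally different tangent space; generalizing the point permits the identification.
  have aux : ∀ (y : M) (w : TangentSpace 𝓘(ℝ, E) y), y = x → (w : E) = (η : E) →
      chartVecL p y w = u := by
    rintro y w rfl hw
    have hw' : w = η := hw
    rw [hw', hη]
    exact chartVecL_vecAt hz u
  exact aux _ _ (by rw [zero_smul, R.map_zero]) (R.deriv_zero x η)

/-- The derivative of the retraction along the fibers, in a chart. -/
def fiberDeriv (R : Retraction E M) (p : M) (q : E × E) : E →L[ℝ] E :=
  (fderiv ℝ (chartRetraction R p) q).comp (ContinuousLinearMap.inr ℝ E E)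

lemma fiberDeriv_zero (R : Retraction E M) {p : M} {z : E}
    (hz : z ∈ (extChartAt 𝓘(ℝ, E) p).target) :
    fiberDeriv R p (z, 0) = ContinuousLinearMap.id ℝ E := by
  ext u
  exact fderiv_chartRetraction_zero R hz u

lemma hasStrictFDerivAt_chartRetraction (R : Retraction E M) {p : M} {z v : E}
    (hz : z ∈ (extChartAt 𝓘(ℝ, E) p).target)
    (hR : R ((extChartAt 𝓘(ℝ, E) p).symm z) (vecAt p z v) ∈ (chartAt E p).source) :
    HasStrictFDerivAt (fun v => chartRetraction R p (z, v)) (fiberDeriv R p (z, v)) v := by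
  have h := (contDiffAt_chartRetraction (q := (z, v)) R hz hR).hasStrictFDerivAt (by simp)
  exact h.comp v ((hasStrictFDerivAt_const z v).prodMk (hasStrictFDerivAt_id v))

/-- A map of class `C¹` near `(z, 0)` is Lipschitz in the second variable, at `0`. -/
lemma exists_norm_sub_le_snd {F : Type*} [NormedAddCommGroup F] [NormedSpace ℝ F] {h : E × E → F}
    {z : E} (hh : ContDiffAt ℝ 1 h (z, 0)) :
    ∃ C > 0, ∀ᶠ q in 𝓝 (z, (0 : E)), ‖h q - h (q.1, 0)‖ ≤ C * ‖q.2‖ := by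
  obtain ⟨K, t, ht, hK⟩ := hh.exists_lipschitzOnWith
  refine ⟨K + 1, by positivity, ?_⟩
  have hc : Tendsto (fun q : E × E => (q.1, (0 : E))) (𝓝 (z, 0)) (𝓝 (z, 0)) := by
    have : Continuous fun q : E × E => (q.1, (0 : E)) := by fun_prop
    exact this.tendsto (z, 0)
  filter_upwards [ht, hc.eventually ht] with q h1 h2
  have h3 := hK.norm_sub_le h1 h2
  have h4 : ‖q - (q.1, 0)‖ = ‖q.2‖ := by
    have : q - (q.1, 0) = (0, q.2) := by ext <;> simp
    rw [this]
    simp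
  rw [h4] at h3
  nlinarith [norm_nonneg q.2]

/-- On the zero section the retraction is `z` and its fiber derivative is the identity; both maps
are `C¹`, so they deviate from these values by `O(‖q.2‖)`. -/
lemma exists_chartRetraction_estimates (R : Retraction E M) (p : M) :
    ∃ C > 0, ∀ᶠ q : E × E in 𝓝 (extChartAt 𝓘(ℝ, E) p p, 0),
      ‖chartRetraction R p q - q.1‖ ≤ C * ‖q.2‖ ∧
      ‖fiberDeriv R p q - ContinuousLinearMap.id ℝ E‖ ≤ C * ‖q.2‖ := by
  have hz := mem_extChartAt_target (I := 𝓘(ℝ, E)) p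
  have hρ : ContDiffAt ℝ ∞ (chartRetraction R p) (extChartAt 𝓘(ℝ, E) p p, 0) :=
    contDiffAt_chartRetraction R hz (retraction_zero_mem_source R hz)
  obtain ⟨C₁, hC₁, h₁⟩ := exists_norm_sub_le_snd (hρ.of_le (m := 1) (by simp))
  have hD : ContDiffAt ℝ 1 (fiberDeriv R p) (extChartAt 𝓘(ℝ, E) p p, 0) :=
    (hρ.fderiv_right (m := 1) (by norm_num; exact WithTop.coe_le_coe.2 le_top)).clm_comp
      contDiffAt_const
  obtain ⟨C₂, hC₂, h₂⟩ := exists_norm_sub_le_snd hD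
  refine ⟨max C₁ C₂, lt_max_of_lt_left hC₁, ?_⟩
  have ht : ∀ᶠ q : E × E in 𝓝 (extChartAt 𝓘(ℝ, E) p p, 0),
      q.1 ∈ (extChartAt 𝓘(ℝ, E) p).target :=
    continuous_fst.continuousAt.eventually (extChartAt_target_mem_nhds (I := 𝓘(ℝ, E)) p)
  filter_upwards [h₁, h₂, ht] with q h1 h2 hq
  rw [chartRetraction_zero R hq] at h1
  rw [fiberDeriv_zero R hq] at h2
  refine ⟨h1.trans ?_, h2.trans ?_⟩
  · gcongr
    exact le_max_left _ _
  · gcongr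
    exact le_max_right _ _

/-! ### The differential of a function with locally Lipschitz gradient, in a chart -/

lemma inner_grad_vecAt (f : M → ℝ) {p : M} {z : E} (hz : z ∈ (extChartAt 𝓘(ℝ, E) p).target) (u : E) :
    inner ℝ (grad f ((extChartAt 𝓘(ℝ, E) p).symm z)) (vecAt p z u)
      = metricForm p z (chartVecL p _ (grad f ((extChartAt 𝓘(ℝ, E) p).symm z))) u := by
  rw [metricForm_apply, chartMetric_eq, vecAt_chartVecL hz]

lemma hasFDerivAt_comp_chart_symm_metricForm {f : M → ℝ} (hf : MDifferentiable 𝓘(ℝ, E) 𝓘(ℝ, ℝ) f)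
    {p : M} {z : E} (hz : z ∈ (extChartAt 𝓘(ℝ, E) p).target) :
    HasFDerivAt (fun z => f ((extChartAt 𝓘(ℝ, E) p).symm z))
      (metricForm p z (chartVecL p _ (grad f ((extChartAt 𝓘(ℝ, E) p).symm z)))) z := by
  have h : metricForm p z (chartVecL p _ (grad f ((extChartAt 𝓘(ℝ, E) p).symm z)))
      = (mvfderiv 𝓘(ℝ, E) f ((extChartAt 𝓘(ℝ, E) p).symm z)).comp (vecAt p z) := by
    ext u
    rw [← inner_grad_vecAt f hz, inner_grad]
    rfl
  rw [h]
  exact hasFDerivAt_comp_chart_symm hf hz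

/-- In coordinates the differential of `f` is the metric form applied to the coordinates of the
gradient, a pairing of bounded Lipschitz maps. Its continuity upgrades differentiability to strict
differentiability, which the Clarke chain rule requires. -/
lemma exists_lipschitz_differential [IsRiemannianManifold 𝓘(ℝ, E) M]
    {f : M → ℝ} (hf : IsLocallyLipschitzDifferentiable E f) (p : M) :
    ∃ G : E → E →L[ℝ] ℝ, ∃ C > 0, ∃ δ > 0, ∀ z ∈ Metric.ball (extChartAt 𝓘(ℝ, E) p p) δ,
      HasStrictFDerivAt (fun z => f ((extChartAt 𝓘(ℝ, E) p).symm z)) (G z) z ∧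
      (∀ u, G z u = inner ℝ (grad f ((extChartAt 𝓘(ℝ, E) p).symm z)) (vecAt p z u)) ∧
      ‖G z‖ ≤ C ∧
      ∀ z' ∈ Metric.ball (extChartAt 𝓘(ℝ, E) p p) δ, ‖G z' - G z‖ ≤ C * ‖z' - z‖ := by
  set z₀ := extChartAt 𝓘(ℝ, E) p p with hz₀
  set X : E → E := fun z => chartVecL p ((extChartAt 𝓘(ℝ, E) p).symm z)
    (grad f ((extChartAt 𝓘(ℝ, E) p).symm z)) with hX
  obtain ⟨δ₁, hδ₁, C₁, hC₁, h₁⟩ := exists_lipschitz_chartVecL hf.2 p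
  have hn := extChartAt_target_mem_nhds (I := 𝓘(ℝ, E)) p
  obtain ⟨B, K, C₂, hK, hC₂, hB⟩ := exists_lipschitz_bounded_eventuallyEq hn
    ((contDiffOn_metricForm p).of_le (m := 1) (by simp))
  have hC₂0 : 0 ≤ C₂ := (norm_nonneg (B 0)).trans (hC₂ 0)
  obtain ⟨δ₂, hδ₂, h₂⟩ := Metric.eventually_nhds_iff_ball.1 (hB.and hn)
  set δ := min (min δ₁ δ₂) 1 with hδ
  have hδpos : 0 < δ := by positivity
  have hs1 : ∀ z ∈ Metric.ball z₀ δ, z ∈ Metric.ball z₀ δ₁ := fun z hz =>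
    Metric.ball_subset_ball ((min_le_left _ _).trans (min_le_left _ _)) hz
  have hs2 : ∀ z ∈ Metric.ball z₀ δ, z ∈ Metric.ball z₀ δ₂ := fun z hz =>
    Metric.ball_subset_ball ((min_le_left _ _).trans (min_le_right _ _)) hz
  have hs3 : ∀ z ∈ Metric.ball z₀ δ, ‖z - z₀‖ ≤ 1 := fun z hz => by
    rw [← dist_eq_norm]
    exact (Metric.mem_ball.1 hz).le.trans (min_le_right _ _)
  have hXl : ∀ z ∈ Metric.ball z₀ δ, ∀ z' ∈ Metric.ball z₀ δ, ‖X z' - X z‖ ≤ C₁ * ‖z' - z‖ := by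
    intro z hz z' hz'
    rw [norm_sub_rev z' z]
    exact h₁ z' (hs1 z' hz') z (hs1 z hz)
  have hXb : ∀ z ∈ Metric.ball z₀ δ, ‖X z‖ ≤ ‖X z₀‖ + C₁ := by
    intro z hz
    have h3 := hXl z₀ (Metric.mem_ball_self hδpos) z hz
    have h4 := norm_le_norm_add_norm_sub' (X z) (X z₀)
    nlinarith [hs3 z hz]
  set b := ‖X z₀‖ + C₁ with hb
  have hb0 : 0 ≤ b := by positivity
  set C := K * b + C₂ * C₁ + C₂ * b + 1 with hC
  have hK0 := K.coe_nonneg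
  have q1 : 0 ≤ K * b := by positivity
  have q2 : 0 ≤ C₂ * C₁ := by positivity
  have q3 : 0 ≤ C₂ * b := by positivity
  have hCpos : 0 < C := by positivity
  have hBz : ∀ z ∈ Metric.ball z₀ δ, B z = metricForm p z := fun z hz => (h₂ z (hs2 z hz)).1
  have hGl : ∀ z ∈ Metric.ball z₀ δ, ∀ z' ∈ Metric.ball z₀ δ,
      ‖metricForm p z' (X z') - metricForm p z (X z)‖ ≤ C * ‖z' - z‖ := by
    intro z hz z' hz'
    rw [← hBz z hz, ← hBz z' hz']
    have e : B z' (X z') - B z (X z) = (B z' - B z) (X z') + B z (X z' - X z) := by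
      simp
    have n1 : ‖(B z' - B z) (X z')‖ ≤ K * ‖z' - z‖ * b :=
      (ContinuousLinearMap.le_opNorm _ _).trans
        (mul_le_mul (hK.norm_sub_le _ _) (hXb z' hz') (norm_nonneg _) (by positivity))
    have n2 : ‖B z (X z' - X z)‖ ≤ C₂ * (C₁ * ‖z' - z‖) :=
      (ContinuousLinearMap.le_opNorm _ _).trans
        (mul_le_mul (hC₂ _) (hXl z hz z' hz') (norm_nonneg _) hC₂0)
    calc _ ≤ _ := by rw [e]; exact norm_add_le _ _
      _ ≤ K * ‖z' - z‖ * b + C₂ * (C₁ * ‖z' - z‖) := add_le_add n1 n2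
      _ = (K * b + C₂ * C₁) * ‖z' - z‖ := by ring
      _ ≤ C * ‖z' - z‖ := by
        gcongr
        linarith
  refine ⟨fun z => metricForm p z (X z), C, hCpos, δ, hδpos, fun z hz => ⟨?_, fun u => ?_, ?_, ?_⟩⟩
  · refine hasStrictFDerivAt_of_hasFDerivAt_of_continuousAt (𝕜 := ℝ)
      (f' := fun z => metricForm p z (X z)) ?_ ?_
    · filter_upwards [Metric.isOpen_ball.mem_nhds hz] with z' hz'
      exact hasFDerivAt_comp_chart_symm_metricForm hf.1 (h₂ z' (hs2 z' hz')).2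
    · rw [Metric.continuousAt_iff']
      intro e he
      have h5 : Tendsto (fun z' => C * ‖z' - z‖) (𝓝 z) (𝓝 (C * ‖z - z‖)) := by
        apply Continuous.tendsto
        fun_prop
      rw [sub_self, norm_zero, mul_zero] at h5
      filter_upwards [Metric.isOpen_ball.mem_nhds hz, h5.eventually (gt_mem_nhds he)] with z' hz' h6
      rw [dist_eq_norm]
      exact (hGl z hz z' hz').trans_lt h6
  · exact (inner_grad_vecAt f (h₂ z (hs2 z hz)).2 u).symm
  · simp only [← hBz z hz]
    calc _ ≤ _ := ContinuousLinearMap.le_opNorm _ _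
      _ ≤ C₂ * b := mul_le_mul (hC₂ _) (hXb z hz) (norm_nonneg _) hC₂0
      _ ≤ C := by linarith
  · exact hGl z hz

/-! ### Transfer of stationarity to the subdifferential at the new point -/

/-- With `y = Rₓ η` and `ψ = R_y⁻¹ ∘ Rₓ` near `η`, one has `ℓₓ = (f + g) ∘ R_y ∘ ψ + ⟪grad f x, ·⟫ +
(Lt / 2) ‖·‖² - f ∘ Rₓ`. All terms but the first are strictly differentiable, so
`le_clarkeDirDeriv_of_prox` applies; a direction `w` at `y` is pulled back to `x` by the inverse of
`A`, the derivative of `ψ` in coordinates. -/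
lemma le_clarkeDirDeriv_of_stationary {R : Retraction E M} {f g : M → ℝ} {Lt : ℝ} {p : M} {z v zy : E}
    (hz : z ∈ (extChartAt 𝓘(ℝ, E) p).target) (hzy : chartRetraction R p (z, v) = zy)
    (hR : R ((extChartAt 𝓘(ℝ, E) p).symm z) (vecAt p z v) ∈ (chartAt E p).source)
    {A : E ≃L[ℝ] E} (hA : (A : E →L[ℝ] E) = fiberDeriv R p (z, v))
    {Gy Gz : E →L[ℝ] ℝ}
    (hGy : HasStrictFDerivAt (fun z => f ((extChartAt 𝓘(ℝ, E) p).symm z)) Gy zy)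
    (hGz : ∀ u, Gz u = inner ℝ (grad f ((extChartAt 𝓘(ℝ, E) p).symm z)) (vecAt p z u))
    {K : ℝ} {U : Set (TangentSpace 𝓘(ℝ, E) ((extChartAt 𝓘(ℝ, E) p).symm zy))} (hU : U ∈ 𝓝 0)
    (hK : ∀ a ∈ U, ∀ b ∈ U, |(f (R _ a) + g (R _ a)) - (f (R _ b) + g (R _ b))| ≤ K * ‖a - b‖)
    (h0 : 0 ∈ clarkeSubdiff (proxObj R f g Lt ((extChartAt 𝓘(ℝ, E) p).symm z)) (vecAt p z v)) :
    ∀ w : TangentSpace 𝓘(ℝ, E) ((extChartAt 𝓘(ℝ, E) p).symm zy), ((Gy (chartVecL p _ w) - Gz (A.symm (chartVecL p _ w))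
      - Lt * inner ℝ (vecAt p z v) (vecAt p z (A.symm (chartVecL p _ w))) : ℝ) : EReal)
      ≤ clarkeDirDeriv (fun η => f (R ((extChartAt 𝓘(ℝ, E) p).symm zy) η)
        + g (R ((extChartAt 𝓘(ℝ, E) p).symm zy) η)) 0 w := by
  set φ := extChartAt 𝓘(ℝ, E) p with hφ
  set x := φ.symm z with hx
  set y := φ.symm zy with hy
  have hzyT : zy ∈ φ.target := by
    rw [← hzy]
    exact φ.map_source (by rw [hφ, extChartAt_source]; exact hR)
  have hyR : R x (vecAt p z v) = y := by
    rw [hy, ← hzy]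
    exact (φ.left_inv (by rw [hφ, extChartAt_source]; exact hR)).symm
  -- the retraction at `y` is locally invertible
  have hρy : HasStrictFDerivAt (fun v => chartRetraction R p (zy, v))
      ((ContinuousLinearEquiv.refl ℝ E : E ≃L[ℝ] E) : E →L[ℝ] E) 0 := by
    have := hasStrictFDerivAt_chartRetraction R hzyT (retraction_zero_mem_source R hzyT)
    rwa [fiberDeriv_zero R hzyT] at this
  set σ := hρy.localInverse with hσ
  have hy0 : chartRetraction R p (zy, 0) = zy := chartRetraction_zero R hzyT
  have hσd : HasStrictFDerivAt σ (ContinuousLinearMap.id ℝ E) zy := by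
    have := hρy.to_localInverse
    rw [hy0] at this
    exact this
  have hσ0 : σ zy = 0 := by
    have := hρy.localInverse_apply_image
    rw [hy0] at this
    exact this
  have hσr : ∀ᶠ w in 𝓝 zy, chartRetraction R p (zy, σ w) = w := by
    have := hρy.eventually_right_inverse
    rw [hy0] at this
    exact this
  -- the retraction at `x`
  set η := vecAt p z v with hη
  have hcv : chartVecL p x η = v := chartVecL_vecAt hz v
  have hρx : HasStrictFDerivAt (fun η' => chartRetraction R p (z, chartVecL p x η'))
      ((A : E →L[ℝ] E).comp (chartVecL p x)) η := by
    have h1 : HasStrictFDerivAt (fun v => chartRetraction R p (z, v)) (A : E →L[ℝ] E)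
        (chartVecL p x η) := by
      rw [hcv, hA]
      exact hasStrictFDerivAt_chartRetraction R hz hR
    exact h1.comp η (chartVecL p x).hasStrictFDerivAt
  have hρxη : chartRetraction R p (z, chartVecL p x η) = zy := by rw [hcv, hzy]
  -- The local inverse `σ` has derivative the identity at `zy`, so the derivative of `ψ` in
  -- coordinates is that of the retraction at `x`, namely `A`.
  have hψ : HasStrictFDerivAt
      (fun η' => vecAt p zy (σ (chartRetraction R p (z, chartVecL p x η'))))
      ((vecAt p zy).comp ((A : E →L[ℝ] E).comp (chartVecL p x))) η := by
    have h1 : HasStrictFDerivAt σ (ContinuousLinearMap.id ℝ E)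
        (chartRetraction R p (z, chartVecL p x η)) := by rwa [hρxη]
    have h2 := h1.comp η hρx
    rw [ContinuousLinearMap.id_comp] at h2
    exact (vecAt p zy).hasStrictFDerivAt.comp η h2
  have hψ0 : vecAt p zy (σ (chartRetraction R p (z, chartVecL p x η))) = 0 := by
    rw [hρxη, hσ0, map_zero]
  have hsrc : ∀ᶠ η' in 𝓝 η, R x η' ∈ (chartAt E p).source :=
    (continuousAt_retraction_fiber R hz η).eventually
      ((chartAt E p).open_source.mem_nhds hR)
  have hRψ : ∀ᶠ η' in 𝓝 η,
      R y (vecAt p zy (σ (chartRetraction R p (z, chartVecL p x η')))) = R x η' := by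
    have t1 : Tendsto (fun η' => chartRetraction R p (z, chartVecL p x η')) (𝓝 η) (𝓝 zy) := by
      have := hρx.hasFDerivAt.continuousAt.tendsto
      rwa [hρxη] at this
    have t2 : Tendsto (fun η' => R y (vecAt p zy (σ (chartRetraction R p (z, chartVecL p x η')))))
        (𝓝 η) (𝓝 y) := by
      have h1 : Tendsto (fun η' => R y η') (𝓝 0) (𝓝 (R y 0)) :=
        continuousAt_retraction_fiber R hzyT 0
      have h2 := hψ.hasFDerivAt.continuousAt.tendsto
      rw [hψ0] at h2
      rw [R.map_zero] at h1
      exact h1.comp h2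
    filter_upwards [hsrc, t1.eventually hσr, t2.eventually
      ((chartAt E p).open_source.mem_nhds (chart_symm_mem_source hzyT))] with η' h1 h2 h3
    refine φ.injOn (by rw [hφ, extChartAt_source]; exact h3)
      (by rw [hφ, extChartAt_source]; exact h1) ?_
    rw [chartRetraction_apply_chartVecL R hz] at h2 ⊢
    exact h2
  have hfx : HasStrictFDerivAt (fun η' => f (R x η'))
      (Gy.comp ((A : E →L[ℝ] E).comp (chartVecL p x))) η := by
    have h1 : HasStrictFDerivAt (fun z => f (φ.symm z)) Gy
        (chartRetraction R p (z, chartVecL p x η)) := by rwa [hρxη]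
    refine (h1.comp η hρx).congr_of_eventuallyEq ?_
    filter_upwards [hsrc] with η' h2
    rw [chartRetraction_apply_chartVecL R hz, φ.left_inv (by rw [hφ, extChartAt_source]; exact h2)]
  intro w
  obtain ⟨u, hu⟩ : ∃ u, u = A.symm (chartVecL p y w) := ⟨_, rfl⟩
  rw [← hu]
  have h0' : (0 : EReal) ≤ clarkeDirDeriv (proxObj R f g Lt x) η (vecAt p z u) := by
    have := h0 (vecAt p z u)
    rw [inner_zero_left] at this
    exact_mod_cast this
  have key := le_clarkeDirDeriv_of_prox (vecAt p z u) hψ hψ0 hfx hU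
    (h := fun η => f (R y η) + g (R y η)) hK (ℓ := proxObj R f g Lt x) (a := grad f x) (c := Lt) (by
      filter_upwards [hRψ] with η' h1
      rw [h1]
      simp only [proxObj]
      ring) h0'
  have e1 : chartVecL p x (vecAt p z u) = u := chartVecL_vecAt hz u
  have e2 : A u = chartVecL p y w := by rw [hu, A.apply_symm_apply]
  have hw : (vecAt p zy).comp ((A : E →L[ℝ] E).comp (chartVecL p x)) (vecAt p z u) = w := by
    simp only [ContinuousLinearMap.comp_apply, e1, ContinuousLinearEquiv.coe_coe, e2]
    exact vecAt_chartVecL hzyT w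
  have hG : Gy.comp ((A : E →L[ℝ] E).comp (chartVecL p x)) (vecAt p z u) = Gy (chartVecL p y w) := by
    simp only [ContinuousLinearMap.comp_apply, e1, ContinuousLinearEquiv.coe_coe, e2]
  rw [hw, hG, ← hGz] at key
  exact key

lemma exists_inner_eq_of_le {V : Type*} [NormedAddCommGroup V] [InnerProductSpace ℝ V]
    [FiniteDimensional ℝ V] (ψ : V →L[ℝ] ℝ) {B : ℝ} (hB : 0 ≤ B) (h : ∀ w, |ψ w| ≤ B * ‖w‖) :
    ∃ ζ : V, (∀ w, inner ℝ ζ w = ψ w) ∧ ‖ζ‖ ≤ B := by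
  have : CompleteSpace V := FiniteDimensional.complete ℝ V
  refine ⟨(InnerProductSpace.toDual ℝ V).symm ψ,
    fun w => InnerProductSpace.toDual_symm_apply, ?_⟩
  rw [LinearIsometryEquiv.norm_map]
  exact ψ.opNorm_le_bound hB h

/-- Closeness to the identity gives `‖u‖ ≤ 2 * ‖T u‖`, which yields both injectivity and the bound
on the inverse. -/
lemma exists_equiv_of_norm_sub_id_le (T : E →L[ℝ] E)
    (h : ‖T - ContinuousLinearMap.id ℝ E‖ ≤ 1 / 2) :
    ∃ A : E ≃L[ℝ] E, (A : E →L[ℝ] E) = T ∧ ∀ w, ‖A.symm w‖ ≤ 2 * ‖w‖ := by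
  have hlow : ∀ u, ‖u‖ ≤ 2 * ‖T u‖ := fun u => by
    have h1 : ‖T u - u‖ ≤ 1 / 2 * ‖u‖ :=
      ((T - ContinuousLinearMap.id ℝ E).le_opNorm u).trans (by gcongr)
    have h2 : ‖u‖ ≤ ‖T u - u‖ + ‖T u‖ := by
      rw [norm_sub_rev]
      simpa using norm_add_le (u - T u) (T u)
    linarith
  have hinj : Function.Injective (T : E →ₗ[ℝ] E) := by
    rw [← LinearMap.ker_eq_bot, LinearMap.ker_eq_bot']
    intro u hu
    have := hlow u
    rw [show T u = 0 from hu, norm_zero, mul_zero] at this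
    exact norm_le_zero_iff.1 this
  refine ⟨(LinearEquiv.ofInjectiveEndo (T : E →ₗ[ℝ] E) hinj).toContinuousLinearEquiv, ?_, fun w => ?_⟩
  · ext u
    rfl
  · set A := (LinearEquiv.ofInjectiveEndo (T : E →ₗ[ℝ] E) hinj).toContinuousLinearEquiv with hA
    have : T (A.symm w) = w := A.apply_symm_apply w
    simpa [this] using hlow (A.symm w)

lemma exists_lipschitz_comp_retraction {R : Retraction E M} {F : M → ℝ}
    (hF : IsLocallyLipschitzWrt R F) {p : M} {z : E} (hz : z ∈ (extChartAt 𝓘(ℝ, E) p).target) :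
    ∃ K : ℝ, ∃ U ∈ 𝓝 (0 : TangentSpace 𝓘(ℝ, E) ((extChartAt 𝓘(ℝ, E) p).symm z)),
      ∀ a ∈ U, ∀ b ∈ U, |F (R _ a) - F (R _ b)| ≤ K * ‖a - b‖ := by
  have : LocallyCompactSpace M := Manifold.locallyCompact_of_finiteDimensional 𝓘(ℝ, E)
  obtain ⟨K, hK, hKy⟩ := exists_compact_mem_nhds ((extChartAt 𝓘(ℝ, E) p).symm z)
  obtain ⟨L, hL⟩ := hF K hK
  have h1 := continuousAt_retraction_fiber R hz 0
  rw [ContinuousAt, R.map_zero] at h1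
  exact ⟨L, _, h1 hKy, fun a ha b hb => hL _ (mem_of_mem_nhds hKy) a b ha hb⟩

lemma tendsto_retraction_vecAt (R : Retraction E M) (p : M) :
    Tendsto (fun q : E × E => R ((extChartAt 𝓘(ℝ, E) p).symm q.1) (vecAt p q.1 q.2))
      (𝓝 (extChartAt 𝓘(ℝ, E) p p, 0)) (𝓝 p) := by
  have hz := mem_extChartAt_target (I := 𝓘(ℝ, E)) p
  have h1 := (contMDiffAt_retraction_vecAt (q := (extChartAt 𝓘(ℝ, E) p p, 0)) R hz).continuousAt
  rw [ContinuousAt] at h1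
  simpa only [map_zero, R.map_zero, extChartAt_to_inv] using h1

/-- Near a given point, a stationary point `η` of the proximal objective at `x` provides a
subgradient of `f + g` at `Rₓ η` of size `O(‖η‖)`. -/
lemma exists_mem_subdiff_norm_le [IsRiemannianManifold 𝓘(ℝ, E) M] {R : Retraction E M}
    {f g : M → ℝ} (Lt : ℝ)
    (hf : IsLocallyLipschitzDifferentiable E f)
    (hF : IsLocallyLipschitzWrt R (fun y => f y + g y)) (p : M) :
    ∃ C > 0, ∀ᶠ q : E × E in 𝓝 (extChartAt 𝓘(ℝ, E) p p, 0),
      0 ∈ clarkeSubdiff (proxObj R f g Lt ((extChartAt 𝓘(ℝ, E) p).symm q.1)) (vecAt p q.1 q.2) →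
      ∃ ζ ∈ subdiff R (fun y => f y + g y)
        (R ((extChartAt 𝓘(ℝ, E) p).symm q.1) (vecAt p q.1 q.2)), ‖ζ‖ ≤ C * ‖q.2‖ := by
  obtain ⟨G, Cg, hCg, δ, hδ, hG⟩ := exists_lipschitz_differential hf p
  obtain ⟨Cn, hCn, hn⟩ := exists_norm_vecAt_le (E := E) p
  obtain ⟨Cr, hCr, hr⟩ := exists_chartRetraction_estimates R p
  have hT := extChartAt_target_mem_nhds (I := 𝓘(ℝ, E)) p
  have hR := (tendsto_retraction_vecAt R p).eventually (chart_source_mem_nhds E p)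
  have h1 : Tendsto (fun q : E × E => q.1) (𝓝 (extChartAt 𝓘(ℝ, E) p p, 0))
      (𝓝 (extChartAt 𝓘(ℝ, E) p p)) := continuous_fst.tendsto _
  have h2 : Tendsto (chartRetraction R p) (𝓝 (extChartAt 𝓘(ℝ, E) p p, 0))
      (𝓝 (extChartAt 𝓘(ℝ, E) p p)) :=
    (continuousAt_extChartAt (I := 𝓘(ℝ, E)) p).tendsto.comp (tendsto_retraction_vecAt R p)
  have h3 : ∀ᶠ q : E × E in 𝓝 (extChartAt 𝓘(ℝ, E) p p, 0), Cr * ‖q.2‖ < 1 / 2 := by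
    have : Continuous fun q : E × E => Cr * ‖q.2‖ := by fun_prop
    refine (this.tendsto _).eventually_lt_const ?_
    simp
  refine ⟨(3 * Cg * Cr + 2 * |Lt| * Cn ^ 2) * Cn, by positivity, ?_⟩
  filter_upwards [h1.eventually hn, h2.eventually hn, h1.eventually (Metric.ball_mem_nhds _ hδ),
    h2.eventually (Metric.ball_mem_nhds _ hδ), h1.eventually hT, h2.eventually hT, hR, hr, h3]
    with q hn1 hn2 hb1 hb2 ht1 ht2 hRq hrq hq hst
  obtain ⟨z, v⟩ := q
  obtain ⟨zy, hzy⟩ : ∃ zy, chartRetraction R p (z, v) = zy := ⟨_, rfl⟩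
  have hyR : R ((extChartAt 𝓘(ℝ, E) p).symm z) (vecAt p z v) = (extChartAt 𝓘(ℝ, E) p).symm zy := by
    rw [← hzy]
    exact ((extChartAt 𝓘(ℝ, E) p).left_inv (by rw [extChartAt_source]; exact hRq)).symm
  rw [hzy] at hn2 hb2 ht2 hrq
  simp only at hn1 hb1 ht1 hRq hq hst hrq ⊢
  obtain ⟨A, hA, hA2⟩ := exists_equiv_of_norm_sub_id_le (fiberDeriv R p (z, v))
    (hrq.2.trans hq.le)
  obtain ⟨K, U, hU, hK⟩ := exists_lipschitz_comp_retraction hF ht2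
  have key := le_clarkeDirDeriv_of_stationary ht1 hzy hRq hA (hG zy hb2).1 (hG z hb1).2.1 hU hK hst
  rw [hyR]
  have hAid : ∀ u, ‖A u - u‖ ≤ Cr * ‖v‖ * ‖u‖ := fun u => by
    have h4 := (fiberDeriv R p (z, v) - ContinuousLinearMap.id ℝ E).le_opNorm u
    rw [← hA] at h4 hrq
    exact h4.trans (by gcongr; exact hrq.2)
  have hGb := (hG z hb1).2.2.1
  have hGG := ((hG z hb1).2.2.2 zy hb2).trans (mul_le_mul_of_nonneg_left hrq.1 hCg.le)
  have hfin : FiniteDimensional ℝ (TangentSpace 𝓘(ℝ, E) ((extChartAt 𝓘(ℝ, E) p).symm zy)) :=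
    inferInstanceAs (FiniteDimensional ℝ E)
  -- The lower bound for the Clarke derivative is linear in `w`, so its Riesz representative is a
  -- subgradient by definition; only its norm remains to be estimated.
  obtain ⟨ψ, hψ⟩ : ∃ ψ : TangentSpace 𝓘(ℝ, E) ((extChartAt 𝓘(ℝ, E) p).symm zy) →L[ℝ] ℝ,
      ∀ w, ψ w = G zy (chartVecL p _ w) - G z (A.symm (chartVecL p _ w))
        - Lt * inner ℝ (vecAt p z v) (vecAt p z (A.symm (chartVecL p _ w))) :=
    ⟨(G zy - (G z).comp (A.symm : E →L[ℝ] E)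
      - Lt • (innerSL ℝ (vecAt p z v)).comp ((vecAt p z).comp (A.symm : E →L[ℝ] E))).comp
        (chartVecL p _), fun w => rfl⟩
  obtain ⟨ζ, hζ, hζn⟩ := exists_inner_eq_of_le ψ
    (B := (3 * Cg * Cr + 2 * |Lt| * Cn ^ 2) * Cn * ‖v‖) (by positivity) (fun w => by
      rw [hψ]
      obtain ⟨a, ha⟩ : ∃ a, a = chartVecL p _ w := ⟨_, rfl⟩
      obtain ⟨u, hu⟩ : ∃ u, u = A.symm a := ⟨_, rfl⟩
      rw [← ha, ← hu]
      have ha' : ‖a‖ ≤ Cn * ‖w‖ := ha ▸ hn2.2 w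
      have hu' : ‖u‖ ≤ 2 * ‖a‖ := hu ▸ hA2 a
      have hAu : A u = a := by rw [hu, A.apply_symm_apply]
      -- Both pieces are `O(‖v‖)`: the differential is Lipschitz and `zy` is within `Cr * ‖v‖` of
      -- `z`, while `A` differs from the identity by at most `Cr * ‖v‖`.
      have e1 : G zy a - G z u = (G zy - G z) a + G z (A u - u) := by
        rw [hAu]; simp
      have b1 : |(G zy - G z) a| ≤ Cg * (Cr * ‖v‖) * ‖a‖ :=
        ((G zy - G z).le_opNorm a).trans (by gcongr)
      have b2 : |G z (A u - u)| ≤ Cg * (Cr * ‖v‖ * (2 * ‖a‖)) :=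
        ((G z).le_opNorm _).trans (by
          gcongr
          exact (hAid u).trans (by gcongr))
      have b3 : |inner ℝ (vecAt p z v) (vecAt p z u)| ≤ (Cn * ‖v‖) * (Cn * (2 * ‖a‖)) := by
        refine (abs_real_inner_le_norm _ _).trans ?_
        gcongr
        · exact hn1.1 v
        · exact (hn1.1 u).trans (by gcongr)
      have b4 : |Lt * inner ℝ (vecAt p z v) (vecAt p z u)|
          ≤ |Lt| * ((Cn * ‖v‖) * (Cn * (2 * ‖a‖))) := by
        rw [abs_mul]
        gcongr
      have b5 : |G zy a - G z u - Lt * inner ℝ (vecAt p z v) (vecAt p z u)|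
          ≤ (3 * Cg * Cr + 2 * |Lt| * Cn ^ 2) * ‖v‖ * ‖a‖ := by
        rw [e1]
        refine (abs_sub _ _).trans ?_
        refine (add_le_add (abs_add_le _ _) le_rfl).trans ?_
        calc _ ≤ Cg * (Cr * ‖v‖) * ‖a‖ + Cg * (Cr * ‖v‖ * (2 * ‖a‖))
              + |Lt| * ((Cn * ‖v‖) * (Cn * (2 * ‖a‖))) := by gcongr
          _ = _ := by ring
      calc _ ≤ _ := b5
        _ ≤ (3 * Cg * Cr + 2 * |Lt| * Cn ^ 2) * ‖v‖ * (Cn * ‖w‖) := by gcongr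
        _ = _ := by ring)
  refine ⟨ζ, fun w => ?_, hζn⟩
  rw [hζ, hψ]
  exact key w

/-- Passes from a neighborhood of `(p, 0)` in coordinates to a uniform radius in the Riemannian
norm, since coordinates of a vector are bounded by a multiple of its norm near `p`. -/
lemma exists_forall_of_eventually_vecAt {p : M} {P : ∀ x : M, TangentSpace 𝓘(ℝ, E) x → Prop}
    (h : ∀ᶠ q : E × E in 𝓝 (extChartAt 𝓘(ℝ, E) p p, 0),
      P ((extChartAt 𝓘(ℝ, E) p).symm q.1) (vecAt p q.1 q.2)) :
    ∃ V ∈ 𝓝 p, ∃ δ > 0, ∀ x ∈ V, ∀ η : TangentSpace 𝓘(ℝ, E) x, ‖η‖ < δ → P x η := by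
  obtain ⟨Cn, hCn, hn⟩ := exists_norm_vecAt_le (E := E) p
  have hT := extChartAt_target_mem_nhds (I := 𝓘(ℝ, E)) p
  rw [nhds_prod_eq] at h
  obtain ⟨pa, ha, pb, hb, hab⟩ := eventually_prod_iff.1 h
  obtain ⟨r, hr, hball⟩ := Metric.eventually_nhds_iff_ball.1 hb
  refine ⟨{x | x ∈ (extChartAt 𝓘(ℝ, E) p).source ∧ (pa (extChartAt 𝓘(ℝ, E) p x) ∧
      ∀ v : TangentSpace 𝓘(ℝ, E) ((extChartAt 𝓘(ℝ, E) p).symm (extChartAt 𝓘(ℝ, E) p x)),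
      ‖chartVecL p ((extChartAt 𝓘(ℝ, E) p).symm (extChartAt 𝓘(ℝ, E) p x)) v‖ ≤ Cn * ‖v‖)}, ?_,
    r / Cn, by positivity, ?_⟩
  · have hc := (continuousAt_extChartAt (I := 𝓘(ℝ, E)) p).tendsto
    filter_upwards [extChartAt_source_mem_nhds (I := 𝓘(ℝ, E)) p, hc.eventually ha, hc.eventually hn]
      with x h1 h2 h3
    exact ⟨h1, h2, h3.2⟩
  · rintro x ⟨hx, hxa, hxn⟩
    obtain ⟨z, hz⟩ : ∃ z, z = extChartAt 𝓘(ℝ, E) p x := ⟨_, rfl⟩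
    have hzx : (extChartAt 𝓘(ℝ, E) p).symm z = x := by
      rw [hz]; exact (extChartAt 𝓘(ℝ, E) p).left_inv hx
    have hzT : z ∈ (extChartAt 𝓘(ℝ, E) p).target := by
      rw [hz]; exact (extChartAt 𝓘(ℝ, E) p).map_source hx
    rw [← hz] at hxa hxn
    clear hz hx
    subst hzx
    intro η hη
    have h1 := hab hxa (y := chartVecL p _ η) (hball _ (by
      rw [mem_ball_zero_iff]
      refine (hxn η).trans_lt ?_
      rwa [lt_div_iff₀ hCn, mul_comm] at hη))
    have h2 : vecAt p z (chartVecL p _ η) = η := vecAt_chartVecL hzT η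
    rw [← h2]
    exact h1

/-- Uniform estimates for the steps of the method that start near a given point. -/
lemma exists_step_estimates [IsRiemannianManifold 𝓘(ℝ, E) M] {R : Retraction E M}
    {f g : M → ℝ} (Lt : ℝ)
    (hf : IsLocallyLipschitzDifferentiable E f)
    (hF : IsLocallyLipschitzWrt R (fun y => f y + g y)) {p : M} {U : Set M} (hU : U ∈ 𝓝 p) :
    ∃ V ∈ 𝓝 p, ∃ δ > 0, ∃ C ≥ 0, ∀ x ∈ V, ∀ η : TangentSpace 𝓘(ℝ, E) x, ‖η‖ < δ →
      R x η ∈ U ∧ edist x (R x η) ≤ ENNReal.ofReal (C * ‖η‖) ∧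
      (0 ∈ clarkeSubdiff (proxObj R f g Lt x) η →
        ∃ ζ ∈ subdiff R (fun y => f y + g y) (R x η), ‖ζ‖ ≤ C * ‖η‖) ∧
      ∀ η' : TangentSpace 𝓘(ℝ, E) x, ‖η'‖ < δ →
        |(f (R x η) + g (R x η)) - (f (R x η') + g (R x η'))| ≤ C * ‖η - η'‖ := by
  have : LocallyCompactSpace M := Manifold.locallyCompact_of_finiteDimensional 𝓘(ℝ, E)
  obtain ⟨K, hK, hKp⟩ := exists_compact_mem_nhds p
  obtain ⟨LF, hLF⟩ := hF K hK
  obtain ⟨Cs, hCs, hs⟩ := exists_mem_subdiff_norm_le Lt hf hF p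
  obtain ⟨Cn, hCn, hn⟩ := exists_norm_vecAt_le (E := E) p
  obtain ⟨Cr, hCr, hr⟩ := exists_chartRetraction_estimates R p
  obtain ⟨Ce, hCe, ρ, hρ, he⟩ := exists_edist_chart_symm_le (E := E) p
  have hT := extChartAt_target_mem_nhds (I := 𝓘(ℝ, E)) p
  have hR := tendsto_retraction_vecAt R p
  have h1 : Tendsto (fun q : E × E => q.1) (𝓝 (extChartAt 𝓘(ℝ, E) p p, 0))
      (𝓝 (extChartAt 𝓘(ℝ, E) p p)) := continuous_fst.tendsto _
  have h2 : Tendsto (chartRetraction R p) (𝓝 (extChartAt 𝓘(ℝ, E) p p, 0))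
      (𝓝 (extChartAt 𝓘(ℝ, E) p p)) :=
    (continuousAt_extChartAt (I := 𝓘(ℝ, E)) p).tendsto.comp hR
  set C := max (max (Ce * (Cr * Cn)) (Cs * Cn)) LF with hC
  have hC1 : Ce * (Cr * Cn) ≤ C := (le_max_left _ _).trans (le_max_left _ _)
  have hC2 : Cs * Cn ≤ C := (le_max_right _ _).trans (le_max_left _ _)
  have hC3 : LF ≤ C := le_max_right _ _
  have hC0 : 0 ≤ C := le_trans (by positivity) hC1
  obtain ⟨V, hV, δ, hδ, hVδ⟩ := exists_forall_of_eventually_vecAt (E := E) (p := p)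
    (P := fun x η => R x η ∈ U ∧ R x η ∈ K ∧ edist x (R x η) ≤ ENNReal.ofReal (C * ‖η‖) ∧
      (0 ∈ clarkeSubdiff (proxObj R f g Lt x) η →
        ∃ ζ ∈ subdiff R (fun y => f y + g y) (R x η), ‖ζ‖ ≤ C * ‖η‖)) (by
    filter_upwards [h1.eventually hn, h1.eventually hT, h1.eventually (Metric.ball_mem_nhds _ hρ),
      h2.eventually (Metric.ball_mem_nhds _ hρ), hR.eventually (chart_source_mem_nhds E p),
      hR.eventually hU, hR.eventually hKp, hr, hs] with q hnq hzT hb1 hb2 hRs hRU hRK hrq hsq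
    have hq : ‖q.2‖ ≤ Cn * ‖vecAt p q.1 q.2‖ := by
      have := hnq.2 (vecAt p q.1 q.2)
      rwa [chartVecL_vecAt hzT] at this
    refine ⟨hRU, hRK, ?_, fun h0 => ?_⟩
    · have h3 := he _ hb1 _ hb2
      have h4 : (extChartAt 𝓘(ℝ, E) p).symm (chartRetraction R p q)
          = R ((extChartAt 𝓘(ℝ, E) p).symm q.1) (vecAt p q.1 q.2) :=
        (extChartAt 𝓘(ℝ, E) p).left_inv (by rw [extChartAt_source]; exact hRs)
      rw [h4] at h3
      refine h3.trans (ENNReal.ofReal_le_ofReal ?_)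
      calc Ce * ‖chartRetraction R p q - q.1‖ ≤ Ce * (Cr * (Cn * ‖vecAt p q.1 q.2‖)) := by
            gcongr
            exact hrq.1.trans (by gcongr)
        _ = Ce * (Cr * Cn) * ‖vecAt p q.1 q.2‖ := by ring
        _ ≤ _ := by gcongr
    · obtain ⟨ζ, hζ, hζn⟩ := hsq h0
      refine ⟨ζ, hζ, hζn.trans ?_⟩
      calc Cs * ‖q.2‖ ≤ Cs * (Cn * ‖vecAt p q.1 q.2‖) := by gcongr
        _ = Cs * Cn * ‖vecAt p q.1 q.2‖ := by ring
        _ ≤ _ := by gcongr)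
  refine ⟨V ∩ K, inter_mem hV hKp, δ, hδ, C, hC0, fun x hx η hη => ?_⟩
  obtain ⟨e1, e2, e3, e4⟩ := hVδ x hx.1 η hη
  refine ⟨e1, e3, e4, fun η' hη' => ?_⟩
  exact (hLF x hx.2 η η' e2 (hVδ x hx.1 η' hη').2.1).trans (by gcongr)

/-! ### Convergence of the method -/

lemma summable_sub_succ_of_antitone {s : ℕ → ℝ} (hs : Antitone s) (h0 : ∀ k, 0 ≤ s k) :
    Summable fun k => s k - s (k + 1) := by
  refine summable_of_sum_range_le (c := s 0) (fun k => sub_nonneg.2 (hs (Nat.le_succ k)))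
    fun n => ?_
  rw [Finset.sum_range_sub']
  linarith [h0 n]

/-- The extended distance may be infinite between components. The points at finite distance from `x`
form a clopen set, and the curve `t ↦ R x (t • η)` is connected and starts at `x`. -/
lemma edist_retraction_lt_top (R : Retraction E M) (x : M) (η : TangentSpace 𝓘(ℝ, E) x) :
    edist (R x η) x < ⊤ := by
  have hc : Continuous fun t : ℝ => R x (t • η) := by
    have h1 : Continuous fun t : ℝ => (⟨x, t • η⟩ : TangentBundle 𝓘(ℝ, E) M) :=
      (FiberBundle.continuous_totalSpaceMk E (fun x : M => TangentSpace 𝓘(ℝ, E) x) x).comp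
        (continuous_id.smul continuous_const)
    exact R.smooth.continuous.comp h1
  have hclopen : IsClopen (Metric.eball x ⊤) := ⟨Metric.isClosed_eball_top, Metric.isOpen_eball⟩
  have huniv := (hclopen.preimage hc).eq_univ ⟨0, by simp [R.map_zero]⟩
  have h1 : (1 : ℝ) ∈ (fun t : ℝ => R x (t • η)) ⁻¹' Metric.eball x ⊤ := huniv ▸ mem_univ _
  simpa using h1

/-- Adding the smoothness inequality for `f` to the decrease of the proximal objective cancels the
gradient term and leaves the surplus `Lt - L` of the quadratic one. -/
lemma IsIRPG.succ_le {R : Retraction E M} {f g : M → ℝ} {L Lt : ℝ} {q : ℝ → ℝ → ℝ} {ε : ℕ → ℝ}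
    {x : ℕ → M} {ηh ηs : ∀ k, TangentSpace 𝓘(ℝ, E) (x k)}
    (hx : IsIRPG R f g Lt q ε x ηh ηs) {N : Set M} (hxN : ∀ k, x k ∈ N)
    (hfL : IsRetractionSmooth R f L N) (k : ℕ) :
    (Lt - L) / 2 * ‖ηh k‖ ^ 2 ≤ f (x k) + g (x k) - (f (x (k + 1)) + g (x (k + 1))) := by
  have h1 := hfL (x k) (hxN k) {ηh k} (by
    rw [image_singleton, singleton_subset_iff, ← hx.step k]
    exact hxN (k + 1)) (ηh k) rfl
  have h2 := hx.decrease k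
  simp only [proxObj, inner_zero_right, norm_zero, R.map_zero] at h2
  rw [← hx.step k] at h1 h2
  linarith

/-- The bounds on the steps that start in `s`, from which summability is derived. -/
def HasStepBound (β : ℝ) (ε : ℕ → ℝ) (x : ℕ → M) (ηh ηs : ∀ k, TangentSpace 𝓘(ℝ, E) (x k))
    (s : Set M) : Prop :=
  ∃ C : ℝ, 0 ≤ C ∧ ∃ D : ℕ → ℝ, (∀ k, 0 ≤ D k) ∧ Summable D ∧ ∀ᶠ k in atTop, x k ∈ s →
    edist (x k) (x (k + 1)) ≤ ENNReal.ofReal (C * ‖ηh k‖) ∧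
    β * ‖ηh (k + 1)‖ ^ 2 ≤ C * ε k ^ 2 + C * ‖ηs k‖ * D k

section

variable {β : ℝ} {ε : ℕ → ℝ} {x : ℕ → M} {ηh ηs : ∀ k, TangentSpace 𝓘(ℝ, E) (x k)}

lemma HasStepBound.of_eventually_notMem {s : Set M} (h : ∀ᶠ k in atTop, x k ∉ s) :
    HasStepBound β ε x ηh ηs s :=
  ⟨0, le_rfl, 0, fun _ => le_rfl, summable_zero, h.mono fun _ h1 h2 => absurd h2 h1⟩

lemma HasStepBound.mono {s t : Set M} (hst : s ⊆ t) (h : HasStepBound β ε x ηh ηs t) :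
    HasStepBound β ε x ηh ηs s := by
  obtain ⟨C, hC, D, hD0, hD, hk⟩ := h
  exact ⟨C, hC, D, hD0, hD, hk.mono fun k h hs => h (hst hs)⟩

/-- Constants and error sequences may be added, since both bounds are monotone in them. This
stability under unions is what lets finitely many local bounds cover a compact set. -/
lemma HasStepBound.union {s t : Set M} (hs : HasStepBound β ε x ηh ηs s)
    (ht : HasStepBound β ε x ηh ηs t) : HasStepBound β ε x ηh ηs (s ∪ t) := by
  obtain ⟨C, hC, D, hD0, hD, hk⟩ := hs
  obtain ⟨C', hC', D', hD0', hD', hk'⟩ := ht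
  refine ⟨C + C', add_nonneg hC hC', D + D', fun k => add_nonneg (hD0 k) (hD0' k), hD.add hD', ?_⟩
  filter_upwards [hk, hk'] with k h h' hu
  have hC1 : C ≤ C + C' := by linarith
  have hC2 : C' ≤ C + C' := by linarith
  have hD1 : D k ≤ (D + D') k := by simpa using hD0' k
  have hD2 : D' k ≤ (D + D') k := by simpa using hD0 k
  have := hD0 k
  have := hD0' k
  rcases hu with hu | hu
  · refine ⟨(h hu).1.trans (ENNReal.ofReal_le_ofReal (by gcongr)), (h hu).2.trans (by gcongr)⟩
  · refine ⟨(h' hu).1.trans (ENNReal.ofReal_le_ofReal (by gcongr)), (h' hu).2.trans (by gcongr)⟩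

variable [IsRiemannianManifold 𝓘(ℝ, E) M] {R : Retraction E M} {f g : M → ℝ} {Lt : ℝ}

/-- The KL inequality is applied at `R (x k) (ηs k)`, where stationarity gives a subgradient of norm
at most `C * ‖ηs k‖`; its value of `f + g` is within `C * ε k ^ 2` of that at `x (k + 1)`. Concavity
converts this into a bound for the next decrease, which dominates `β * ‖ηh (k + 1)‖ ^ 2`. -/
lemma exists_hasStepBound_of_hasKLAt (hx : IsIRPG R f g Lt (fun e _ => e ^ 2) ε x ηh ηs)
    (hf : IsLocallyLipschitzDifferentiable E f)
    (hF : IsLocallyLipschitzWrt R (fun y => f y + g y)) {p : M}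
    (hKL : HasKLAt R (fun y => f y + g y) p)
    (hβ : ∀ k, β * ‖ηh k‖ ^ 2 ≤ f (x k) + g (x k) - (f (x (k + 1)) + g (x (k + 1))))
    (hanti : Antitone fun k => f (x k) + g (x k))
    (hlim : Tendsto (fun k => f (x k) + g (x k)) atTop (𝓝 (f p + g p)))
    (hηh : Tendsto (fun k => ‖ηh k‖) atTop (𝓝 0)) (hηs : Tendsto (fun k => ‖ηs k‖) atTop (𝓝 0))
    (hε : Tendsto ε atTop (𝓝 0)) :
    ∃ V ∈ 𝓝 p, HasStepBound β ε x ηh ηs V := by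
  obtain ⟨ε₀, hε₀, U, hU, ς, -, hconc, hnn, -, -, hder, hineq⟩ := hKL
  obtain ⟨V, hV, δ, hδ, C, hC, hest⟩ := exists_step_estimates Lt hf hF hU
  -- A real level below `ε₀`, which may be infinite; values below `t` stay strictly inside the
  -- domain of `ς`.
  obtain ⟨t, ht0, htε⟩ := EReal.lt_iff_exists_real_btwn.1 hε₀
  have ht0 : 0 < t := by exact_mod_cast ht0
  obtain ⟨a, ha⟩ : ∃ a : ℕ → ℝ, ∀ k, a k = f (x k) + g (x k) - (f p + g p) := ⟨_, fun _ => rfl⟩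
  have haanti : Antitone a := fun i j hij => by
    rw [ha, ha]
    exact sub_le_sub_right (hanti hij) _
  have halim : Tendsto a atTop (𝓝 0) := by
    have := hlim.sub_const (f p + g p)
    rw [sub_self] at this
    exact this.congr fun k => (ha k).symm
  have ha0 : ∀ k, 0 ≤ a k := fun k => haanti.le_of_tendsto halim k
  obtain ⟨k₀, hk₀⟩ := eventually_atTop.1 (halim.eventually_lt_const ht0)
  have hlt : ∀ r : ℝ, r < t → (r : EReal) < ε₀ := fun r hr =>
    (EReal.coe_lt_coe_iff.2 hr).trans htε
  -- Freezing the index before `k₀` makes `s` antitone and nonnegative for all `k`, although `ς (a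
  -- k)` is controlled only once `a k < t`.
  obtain ⟨s, hs⟩ : ∃ s : ℕ → ℝ, ∀ k, s k = ς (a (max k k₀)) := ⟨_, fun _ => rfl⟩
  have hsanti : Antitone s := fun i j hij => by
    rw [hs, hs]
    exact le_of_concave_of_deriv_pos hconc hder (ha0 _) (haanti (max_le_max_right k₀ hij))
      (hlt _ (hk₀ _ (le_max_right _ _)))
  have hs0 : ∀ k, 0 ≤ s k := fun k => by
    rw [hs]
    exact hnn _ (ha0 _) (hlt _ (hk₀ _ (le_max_right _ _))).le
  refine ⟨V, hV, C, hC, fun k => s (k + 1) - s (k + 2),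
    fun k => sub_nonneg.2 (hsanti (Nat.le_succ _)),
    (summable_nat_add_iff 1).2 (summable_sub_succ_of_antitone hsanti hs0), ?_⟩
  have hsmall : ∀ᶠ k in atTop, a (k + 1) + C * ε k ^ 2 < t := by
    have h1 : Tendsto (fun k => a (k + 1) + C * ε k ^ 2) atTop (𝓝 (0 + C * 0 ^ 2)) :=
      ((tendsto_add_atTop_iff_nat 1).2 halim).add ((hε.pow 2).const_mul C)
    exact h1.eventually_lt_const (by simpa using ht0)
  filter_upwards [hsmall, hηh.eventually_lt_const hδ, hηs.eventually_lt_const hδ,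
    eventually_ge_atTop k₀] with k hk hk1 hk2 hkk hkV
  obtain ⟨-, hd, -, -⟩ := hest (x k) hkV (ηh k) hk1
  obtain ⟨hyU, -, hsub, hlip⟩ := hest (x k) hkV (ηs k) hk2
  obtain ⟨ζ, hζ, hζn⟩ := hsub (hx.stationary k)
  refine ⟨by rw [hx.step k]; exact hd, ?_⟩
  obtain ⟨b, hb⟩ : ∃ b : ℝ, b = f (R (x k) (ηs k)) + g (R (x k) (ηs k)) - (f p + g p) := ⟨_, rfl⟩
  have hba : |b - a (k + 1)| ≤ C * ε k ^ 2 := by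
    have h1 := hlip (ηh k) hk1
    rw [← hx.step k] at h1
    rw [hb, ha, sub_sub_sub_cancel_right]
    refine h1.trans (mul_le_mul_of_nonneg_left ?_ hC)
    rw [norm_sub_rev]
    exact hx.accuracy k
  have hbt : b < t := by linarith [(abs_le.1 hba).2]
  have hak : a (k + 1) < t := hk₀ _ (by omega)
  -- The KL inequality is required only for `b > 0`: the exact step may overshoot to a value at or
  -- below the limit, a case that the lemma covers by the error `C * ε k ^ 2` alone.
  have key := sub_le_add_mul_sub_of_concave hconc hder (ha0 (k + 2)) (haanti (Nat.le_succ (k + 1)))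
    (hlt _ hak) (hlt _ hbt) hba (m := C * ‖ηs k‖) (by positivity) (fun hb0 => by
      have h1 := hineq _ hyU (by simp only; linarith) (by
        simp only
        rw [← hb]
        exact hlt _ hbt)
      simp only at h1
      rw [← hb] at h1
      have h2 : distZeroSubdiff R (fun y => f y + g y) (R (x k) (ηs k))
          ≤ ENNReal.ofReal (C * ‖ηs k‖) := by
        refine (iInf₂_le ζ hζ).trans ?_
        rw [← ofReal_norm]
        exact ENNReal.ofReal_le_ofReal hζn
      have h3 := h1.trans (mul_le_mul_right h2 _)
      rw [← ENNReal.ofReal_mul (hder b hb0 (hlt _ hbt)).le] at h3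
      exact ENNReal.one_le_ofReal.1 h3)
  have hβk := hβ (k + 1)
  rw [hs, hs, max_eq_left (by omega), max_eq_left (by omega)]
  refine le_trans (hβk.trans (le_of_eq ?_)) key
  rw [ha, ha]
  ring

end

end Coordinates

/-! ### From finite length to a single accumulation point -/

lemma tsum_lt_top_of_tail {u : ℕ → ℝ≥0∞} (hu : ∀ k, u k < ⊤) (n : ℕ)
    (h : ∑' k, u (k + n) < ⊤) : ∑' k, u k < ⊤ := by
  rw [← (ENNReal.summable (f := fun k => u (k + n))).sum_add_tsum_nat_add']
  exact ENNReal.add_lt_top.2 ⟨ENNReal.sum_lt_top.2 fun k _ => hu k, h⟩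

/-- Finite length makes the sequence Cauchy; a cluster point given by compactness is then its limit,
so completeness of the space is not needed. -/
lemma exists_setOf_mapClusterPt_eq_singleton {X : Type*} [EMetricSpace X] {x : ℕ → X} {K : Set X}
    (h : ∑' k, edist (x k) (x (k + 1)) < ⊤) (hK : IsCompact K) (hx : ∀ k, x k ∈ K) :
    ∃ y, {z : X | MapClusterPt z atTop x} = {y} := by
  have hcauchy : CauchySeq x :=
    cauchySeq_of_edist_le_of_tsum_ne_top _ (fun k => le_rfl) h.ne
  obtain ⟨y, -, hy⟩ := hK.exists_mapClusterPt_of_frequently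
    (Frequently.of_forall (f := atTop) hx)
  have hxy : Tendsto x atTop (𝓝 y) := le_nhds_of_cauchy_adhp hcauchy hy
  refine ⟨y, Subset.antisymm (fun z hz => ?_) (singleton_subset_iff.2 hy)⟩
  exact eq_of_nhds_neBot (hz.neBot.mono (inf_le_inf_left _ hxy))

end IRPG

/-! ### Proof of the theorem -/

theorem theorem3p2
    {E : Type*} [NormedAddCommGroup E] [NormedSpace ℝ E] [FiniteDimensional ℝ E]
    {M : Type*} [EMetricSpace M] [ChartedSpace E M] [IsManifold 𝓘(ℝ, E) ∞ M]
    [RiemannianBundle (fun x : M => TangentSpace 𝓘(ℝ, E) x)]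
    [IsContMDiffRiemannianBundle 𝓘(ℝ, E) ∞ E (fun x : M => TangentSpace 𝓘(ℝ, E) x)]
    [IsRiemannianManifold 𝓘(ℝ, E) M]
    (R : IRPG.Retraction E M) (f g : M → ℝ) (hg : Continuous g)
    (L Lt : ℝ) (hLt : 0 < Lt) (hL : L < Lt)
    (ε : ℕ → ℝ) (hε : Summable ε)
    (x : ℕ → M) (ηh ηs : ∀ k, TangentSpace 𝓘(ℝ, E) (x k))
    (hx : IRPG.IsIRPG R f g Lt (fun e _ => e ^ 2) ε x ηh ηs)
    (hbdd : BddBelow (range (fun y => f y + g y)))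
    (hcomp : IsCompact {y : M | f y + g y ≤ f (x 0) + g (x 0)})
    (N : Set M) (hN : {y : M | f y + g y ≤ f (x 0) + g (x 0)} ⊆ N) (hxN : ∀ k, x k ∈ N)
    (hfL : IRPG.IsRetractionSmooth R f L N)
    (hf : IRPG.IsLocallyLipschitzDifferentiable E f)
    (hF : IRPG.IsLocallyLipschitzWrt R (fun y => f y + g y))
    (hKL : ∀ y, MapClusterPt y atTop x → IRPG.HasKLAt R (fun y => f y + g y) y) :
    ∑' k, edist (x k) (x (k + 1)) < ⊤ ∧ ∃ y, {z : M | MapClusterPt z atTop x} = {y} := by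
  have hβpos : 0 < (Lt - L) / 2 := by linarith
  have hdesc := fun k => hx.succ_le hxN hfL k
  have hanti : Antitone fun k => f (x k) + g (x k) := antitone_nat_of_succ_le fun k => by
    have := hdesc k
    have : 0 ≤ (Lt - L) / 2 * ‖ηh k‖ ^ 2 := by positivity
    linarith
  have hxΩ : ∀ k, x k ∈ {y : M | f y + g y ≤ f (x 0) + g (x 0)} := fun k => hanti (Nat.zero_le k)
  have hFc : Continuous fun y => f y + g y := hf.1.continuous.add hg
  have hbdd' : BddBelow (range fun k => f (x k) + g (x k)) :=
    hbdd.mono (range_subset_iff.2 fun k => mem_range_self (x k))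
  have hlim := tendsto_atTop_ciInf hanti hbdd'
  have hdiff : Tendsto (fun k => f (x k) + g (x k) - (f (x (k + 1)) + g (x (k + 1)))) atTop (𝓝 0) := by
    have := hlim.sub ((tendsto_add_atTop_iff_nat 1).2 hlim)
    rwa [sub_self] at this
  have hηh : Tendsto (fun k => ‖ηh k‖) atTop (𝓝 0) := by
    have h1 : Tendsto (fun k => ‖ηh k‖ ^ 2) atTop (𝓝 0) := by
      have h2 := hdiff.div_const ((Lt - L) / 2)
      rw [zero_div] at h2
      refine squeeze_zero (fun k => by positivity) (fun k => ?_) h2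
      rw [le_div_iff₀ hβpos, mul_comm]
      exact hdesc k
    have h2 := h1.sqrt
    simpa only [Real.sqrt_zero, Real.sqrt_sq (norm_nonneg _)] using h2
  have hε0 := hε.tendsto_atTop_zero
  have hms : ∀ k, ‖ηs k‖ ≤ ‖ηh k‖ + ε k ^ 2 := fun k => by
    have h1 := hx.accuracy k
    rw [norm_sub_rev] at h1
    calc ‖ηs k‖ = ‖ηh k + (ηs k - ηh k)‖ := by rw [add_sub_cancel]
      _ ≤ ‖ηh k‖ + ε k ^ 2 := (norm_add_le _ _).trans (add_le_add_right h1 _)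
  have hηs : Tendsto (fun k => ‖ηs k‖) atTop (𝓝 0) := by
    have h1 := hηh.add (hε0.pow 2)
    rw [zero_pow two_ne_zero, add_zero] at h1
    exact squeeze_zero (fun k => norm_nonneg _) hms h1
  have hbound : IRPG.HasStepBound ((Lt - L) / 2) ε x ηh ηs
      {y : M | f y + g y ≤ f (x 0) + g (x 0)} := by
    -- The KL data and the chart constants depend on the point. Around an accumulation point the KL
    -- lemma gives a bound, around any other point the sequence eventually leaves a neighborhood,
    -- and compactness glues these bounds.
    refine hcomp.induction_on (p := IRPG.HasStepBound ((Lt - L) / 2) ε x ηh ηs)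
      (.of_eventually_notMem (.of_forall fun _ => notMem_empty _)) (fun s t => .mono)
      (fun s t => .union) fun p _ => ?_
    by_cases hp : MapClusterPt p atTop x
    -- Continuity of `f + g` identifies its value at an accumulation point with the limit of the
    -- monotone sequence of values.
    · have hFp : f p + g p = ⨅ k, f (x k) + g (x k) :=
        eq_of_nhds_neBot ((hp.continuousAt_comp hFc.continuousAt).neBot.mono
          (inf_le_inf_left _ hlim))
      obtain ⟨V, hV, h⟩ := IRPG.exists_hasStepBound_of_hasKLAt hx hf hF (hKL p hp) hdesc hanti
        (hFp ▸ hlim) hηh hηs hε0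
      exact ⟨V, mem_nhdsWithin_of_mem_nhds hV, h⟩
    · rw [mapClusterPt_iff_frequently] at hp
      push Not at hp
      obtain ⟨V, hV, h⟩ := hp
      exact ⟨V, mem_nhdsWithin_of_mem_nhds hV, .of_eventually_notMem h⟩
  obtain ⟨C, hC, D, hD0, hD, hev⟩ := hbound
  obtain ⟨k₀, hk₀⟩ := eventually_atTop.1 hev
  have hsum : Summable fun k => ‖ηh (k + k₀)‖ :=
    IRPG.summable_of_sq_succ_le (m := fun k => ‖ηs (k + k₀)‖) (e := fun k => ε (k + k₀))
      (D := fun k => D (k + k₀)) hβpos hC hC (fun k => norm_nonneg _) (fun k => norm_nonneg _)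
      (fun k => (hx.eps_pos _).le) (fun k => hD0 _) ((summable_nat_add_iff k₀).2 hε)
      ((summable_nat_add_iff k₀).2 hD) (fun k => hms _) fun k => by
        have h1 := (hk₀ (k + k₀) (Nat.le_add_left _ _) (hxΩ _)).2
        rw [show k + 1 + k₀ = k + k₀ + 1 by ring]
        exact h1
  have htail : ∑' k, edist (x (k + k₀)) (x (k + k₀ + 1)) < ⊤ := by
    refine lt_of_le_of_lt (ENNReal.tsum_le_tsum fun k =>
      (hk₀ (k + k₀) (Nat.le_add_left _ _) (hxΩ _)).1) ?_
    rw [← ENNReal.ofReal_tsum_of_nonneg (fun k => by positivity) (hsum.mul_left C)]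
    exact ENNReal.ofReal_lt_top
  -- The bounds hold only from `k₀` on; the finitely many earlier steps have finite length because a
  -- retraction step never leaves the component.
  have htot : ∑' k, edist (x k) (x (k + 1)) < ⊤ := by
    refine IRPG.tsum_lt_top_of_tail (fun k => ?_) k₀ htail
    rw [hx.step k, edist_comm]
    exact IRPG.edist_retraction_lt_top R (x k) (ηh k)
  exact ⟨htot, IRPG.exists_setOf_mapClusterPt_eq_singleton htot hcomp hxΩ⟩
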